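/- Modal formulas are built from propositional variables $p_0,p_1,\dots$ and the constant $\bot$ by $\wedge,\vee,\to,\Box$. Let $\mathbf{K}$ be the set of modal formulas that are true at every world of every model on every Kripke frame, and let $\mathbf{wGrz}=\mathbf{K}\oplus\Box^{+}(\Box(p\to\Box p)\to p)\to p$ be the weak Grzegorczyk logic, where $\Box^{+}\varphi=\varphi\wedge\Box\varphi$ and $\oplus$ denotes closure under modus ponens, necessitation ($\varphi/\Box\varphi$) and uniform substitution. **Theorem.** Let $L$ be a logic (it suffices that $L$ is a set of modal formulas) with $\mathbf{K}\subseteq L\subseteq\mathbf{wGrz}$. Then the problem of deciding the constant fragment of $L$ (given a variable-free modal formula $\varphi$, decide whether $\varphi\in L$) is PSPACE-hard: every language over a finite alphabet that is decidable by a deterministic Turing machine in polynomial space is reducible to it by a many-one reduction computable in polynomial time. -/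

import Mathlib

/-! ### Propositional modal formulas -/

/-- Modal formulas over the propositional variables `p₀, p₁, p₂, …`; the primitive connectives
are `⊥`, `∧`, `∨`, `→` and `□`. -/
inductive ModalFormula : Type
  | var (i : ℕ)
  | bot
  | and (φ ψ : ModalFormula)
  | or (φ ψ : ModalFormula)
  | imp (φ ψ : ModalFormula)
  | box (φ : ModalFormula)

namespace ModalFormula

/-- `□⁺φ = φ ∧ □φ`. -/
def boxPlus (φ : ModalFormula) : ModalFormula := and φ (box φ)

/-- The formula `φ(s(0)/p₀, s(1)/p₁, …)`: simultaneous uniform substitution. -/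
def subst (s : ℕ → ModalFormula) : ModalFormula → ModalFormula
  | var i => s i
  | bot => bot
  | and φ ψ => and (φ.subst s) (ψ.subst s)
  | or φ ψ => or (φ.subst s) (ψ.subst s)
  | imp φ ψ => imp (φ.subst s) (ψ.subst s)
  | box φ => box (φ.subst s)

/-- A formula is constant (variable-free) if no propositional variable occurs in it. -/
def IsConstant : ModalFormula → Prop
  | var _ => False
  | bot => True
  | and φ ψ => φ.IsConstant ∧ ψ.IsConstant
  | or φ ψ => φ.IsConstant ∧ ψ.IsConstant
  | imp φ ψ => φ.IsConstant ∧ ψ.IsConstant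
  | box φ => φ.IsConstant

/-- Truth of a formula at a world of the Kripke model with set of worlds `W`, accessibility
relation `R` and valuation `v`. -/
def Sat {W : Type} (R : W → W → Prop) (v : ℕ → W → Prop) : ModalFormula → W → Prop
  | var i, w => v i w
  | bot, _ => False
  | and φ ψ, w => Sat R v φ w ∧ Sat R v ψ w
  | or φ ψ, w => Sat R v φ w ∨ Sat R v ψ w
  | imp φ ψ, w => Sat R v φ w → Sat R v ψ w
  | box φ, w => ∀ u, R w u → Sat R v φ u

/-- The symbols used to write modal formulas as words. -/
inductive Symbol : Type
  | var
  | tick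
  | bot
  | and
  | or
  | imp
  | box
  deriving DecidableEq

instance : Fintype Symbol :=
  ⟨{.var, .tick, .bot, .and, .or, .imp, .box}, fun x => by cases x <;> decide⟩

/-- The word representing a formula: Polish (prefix) notation, where the variable with index `i`
is written as the symbol `var` followed by `i` ticks. -/
def word : ModalFormula → List Symbol
  | var i => Symbol.var :: List.replicate i Symbol.tick
  | bot => [Symbol.bot]
  | and φ ψ => Symbol.and :: (φ.word ++ ψ.word)
  | or φ ψ => Symbol.or :: (φ.word ++ ψ.word)
  | imp φ ψ => Symbol.imp :: (φ.word ++ ψ.word)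
  | box φ => Symbol.box :: φ.word

end ModalFormula

/-! ### The logics -/

/-- The logic **K**: the formulas true at every world of every model on every Kripke frame. -/
def logicK : Set ModalFormula :=
  {φ | ∀ (W : Type) (R : W → W → Prop) (v : ℕ → W → Prop) (w : W), φ.Sat R v w}

/-- `Λ ⊕ A`: the closure of `Λ ∪ {A}` under modus ponens, Gödel's rule (necessitation) and
the rule of substitution. -/
inductive ModalFormula.Oplus (Λ : Set ModalFormula) (A : ModalFormula) : ModalFormula → Prop
  | base {φ} : φ ∈ Λ → Oplus Λ A φ
  | axm : Oplus Λ A A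
  | mp {φ ψ} : Oplus Λ A (.imp φ ψ) → Oplus Λ A φ → Oplus Λ A ψ
  | nec {φ} : Oplus Λ A φ → Oplus Λ A (.box φ)
  | subst {φ} (s : ℕ → ModalFormula) : Oplus Λ A φ → Oplus Λ A (φ.subst s)

/-- The formula `□⁺(□(p → □p) → p) → p`, where `p` is the variable with index `0`. -/
def wGrzAxiom : ModalFormula :=
  let p := ModalFormula.var 0
  .imp (.boxPlus (.imp (.box (.imp p (.box p))) p)) p

/-- The weak Grzegorczyk logic **wGrz** `= K ⊕ □⁺(□(p → □p) → p) → p`. -/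
def logicWGrz : Set ModalFormula := {φ | ModalFormula.Oplus logicK wGrzAxiom φ}

/-- The constant (variable-free) fragment of a set of formulas. -/
def constantFragment (L : Set ModalFormula) : Set ModalFormula := {φ | φ ∈ L ∧ φ.IsConstant}

/-- The decision problem for a set of formulas, as a set of words: the words that
represent a formula from the set. -/
def decisionProblem (X : Set ModalFormula) : Language ModalFormula.Symbol :=
  {x | ∃ φ ∈ X, φ.word = x}

/-! ### Polynomial space and polynomial-time reductions -/

/-- Deterministic single-tape Turing machines with input alphabet `α`. The tape is infinite to
the right. `δ q a = some (q', b, d)` means: in state `q`, reading `a`, write `b`, move the head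
one cell in the direction `d`, and pass to state `q'`; `δ q a = none` means that the machine
halts. -/
structure SpaceMachine (α : Type) where
  /-- the states -/
  Q : Type
  /-- the tape symbols -/
  Γ : Type
  [finQ : Finite Q]
  [finΓ : Finite Γ]
  /-- the initial state -/
  start : Q
  /-- the accepting states -/
  accept : Set Q
  /-- the blank symbol -/
  blank : Γ
  /-- the tape symbol standing for a letter of the input alphabet -/
  letter : α → Γ
  letter_injective : Function.Injective letter
  letter_ne_blank : ∀ a, letter a ≠ blank
  /-- the transition function -/
  δ : Q → Γ → Option (Q × Γ × Turing.Dir)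

namespace SpaceMachine

variable {α : Type} (M : SpaceMachine α)

/-- A configuration: the state, the position of the head, and the contents of all the cells. -/
structure Cfg where
  state : M.Q
  head : ℕ
  tape : ℕ → M.Γ

/-- The initial configuration: the input occupies the cells `0, 1, …, |x| - 1`, all the other
cells are blank, and the head is at cell `0`. -/
def init (x : List α) : M.Cfg where
  state := M.start
  head := 0
  tape i := (x[i]?).elim M.blank M.letter

/-- The new head position. An attempt to move left from the leftmost cell leaves the head there
(truncated subtraction). -/
def moveHead : Turing.Dir → ℕ → ℕ
  | .left, i => i - 1
  | .right, i => i + 1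

/-- One step of the computation; `none` if the machine halts. -/
def step (c : M.Cfg) : Option M.Cfg :=
  (M.δ c.state (c.tape c.head)).map fun r =>
    { state := r.1
      head := moveHead r.2.2 c.head
      tape := Function.update c.tape c.head r.2.1 }

/-- On the input `x`, the head only ever scans cells among the first `s` cells of the tape. -/
def RunsInSpace (x : List α) (s : ℕ) : Prop :=
  ∀ c, StateTransition.Reaches M.step (M.init x) c → c.head < s

/-- The machine halts on every input, and it halts in an accepting state exactly on the words
of `A`. -/
def Decides (A : Language α) : Prop :=
  ∀ x, ∃ c ∈ StateTransition.eval M.step (M.init x), (c.state ∈ M.accept ↔ x ∈ A)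

end SpaceMachine

/-- **PSPACE**: the languages decided by a deterministic Turing machine whose space on
inputs of length `n` is bounded by a polynomial in `n`. -/
def InPSPACE {α : Type} (A : Language α) : Prop :=
  ∃ (M : SpaceMachine α) (p : Polynomial ℕ),
    M.Decides A ∧ ∀ x : List α, M.RunsInSpace x (p.eval x.length)

/-- Polynomial-time many-one reducibility: some function `f` on words, computable by a Turing
machine in polynomial time, satisfies `x ∈ A ↔ f x ∈ B`. Words are presented to the machine as
they are, so the encodings are the identity. -/
def PolyTimeReducible {α β : Type} (A : Language α) (B : Language β) : Prop :=
  ∃ f : List α → List β,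
    Nonempty (Turing.TM2ComputableInPolyTime (id : List α → List α) (id : List β → List β) f) ∧
      ∀ x, x ∈ A ↔ f x ∈ B

/-- **PSPACE-hardness**: every language from PSPACE, over any finite alphabet, is polynomial-time
many-one reducible to `B`. -/
def PSPACEHard {β : Type} (B : Language β) : Prop :=
  ∀ (α : Type) [Finite α] (A : Language α), InPSPACE A → PolyTimeReducible A B

/-! Every language `A` in PSPACE is reduced to the constant fragment by one constant formula per
input, which lies in `logicK` if the machine accepts and outside `logicWGrz` if it does not. This
settles every `L` between the two logics at once. The formula is the negation of a conjunction
describing a binary tree of depth `s`. A node of level `j` carries three configurations: number 0 at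
the start and number 1 at the end of a time interval of length `2 ^ (s - j)`, and number 2 at its
midpoint. The first child treats the first half of the interval and the second child the second
half; at level `s` configuration 1 is the successor of configuration 0. The root starts with the
input, and its final configuration is required not to be accepting. The bound `s` is polynomial in
the input length, and `2 ^ s` exceeds the number of configurations, so the run has halted by time `2
^ s` (`step_run_eq_none`). If the machine accepts, no Kripke model satisfies the conjunction: by
induction on the height, any model is forced to contain the actual run (`contains_iterate`,
`not_accept_of_sat_conjuncts`). Nothing about the formulas `atomF m`, which replace the variables,
is used here. If it does not accept, an explicit transitive frame without infinite strictly
ascending chains satisfies the conjunction (`sat_conjuncts`), and such frames validate `wGrz`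
(`sat_of_mem_logicWGrz`). In this frame `atomF m` says that the `m`-th gadget point is visible.
Transitivity makes a node see all the gadgets of its descendants, so these formulas cannot be
prescribed freely. The remedy is to index each variable by a level and to use it only at nodes of
that level: proper descendants have larger levels and cannot interfere (`varAt_fact_iff`).
Polynomial time is shown by writing the formula with a small language of loops over stacks, compiled
to `TM2` machines (`Run.stepsTo`, `runs_reductionProg`). -/

namespace ModalFormula

/-! ### Constant formulas in place of variables, and their semantics. -/

/-- `¬φ`, expressed as `φ → ⊥`. -/
def neg (φ : ModalFormula) : ModalFormula := imp φ bot

/-- `◇φ`, expressed as `¬□¬φ`. -/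
def dia (φ : ModalFormula) : ModalFormula := neg (box (neg φ))

/-- `□ⁿφ`. -/
def boxes : ℕ → ModalFormula → ModalFormula
  | 0, φ => φ
  | n + 1, φ => box (boxes n φ)

/-- True exactly at the irreflexive points of depth `m` of a transitive frame all of whose
points of finite depth are irreflexive. -/
def chainF (m : ℕ) : ModalFormula := and (boxes (m + 1) bot) (neg (boxes m bot))

/-- True at points that cannot reach a dead end. -/
def serialF : ModalFormula := and (dia (neg bot)) (box (dia (neg bot)))

/-- The formula that holds at the `m`-th gadget point. -/
def gadgetF (m : ℕ) : ModalFormula :=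
  and (dia (chainF m)) (and (neg (dia (chainF (m + 1)))) (dia serialF))

/-- The constant formula that plays the role of the `m`-th propositional variable. -/
def atomF (m : ℕ) : ModalFormula := dia (gadgetF m)

section Sat

variable {W : Type} (R : W → W → Prop) (v : ℕ → W → Prop)

@[simp] theorem sat_bot (w : W) : Sat R v bot w ↔ False := Iff.rfl

@[simp] theorem sat_and (φ ψ : ModalFormula) (w : W) :
    Sat R v (and φ ψ) w ↔ Sat R v φ w ∧ Sat R v ψ w := Iff.rfl

@[simp] theorem sat_imp (φ ψ : ModalFormula) (w : W) :
    Sat R v (imp φ ψ) w ↔ (Sat R v φ w → Sat R v ψ w) := Iff.rfl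

@[simp] theorem sat_box (φ : ModalFormula) (w : W) :
    Sat R v (box φ) w ↔ ∀ u, R w u → Sat R v φ u := Iff.rfl

@[simp] theorem sat_neg (φ : ModalFormula) (w : W) : Sat R v (neg φ) w ↔ ¬ Sat R v φ w := Iff.rfl

@[simp] theorem sat_dia (φ : ModalFormula) (w : W) :
    Sat R v (dia φ) w ↔ ∃ u, R w u ∧ Sat R v φ u := by
  simp [dia]

/-- `IterRel R n w u`: the point `u` can be reached from `w` by `n` steps along `R`. -/
def IterRel {W : Type} (R : W → W → Prop) : ℕ → W → W → Prop
  | 0, w, u => w = u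
  | n + 1, w, u => ∃ w', R w w' ∧ IterRel R n w' u

theorem IterRel.snoc {W : Type} {R : W → W → Prop} {n : ℕ} {w u u' : W}
    (h : IterRel R n w u) (hu : R u u') : IterRel R (n + 1) w u' := by
  induction n generalizing w with
  | zero => cases h; exact ⟨_, hu, rfl⟩
  | succ n ih =>
    obtain ⟨w', hw, h⟩ := h
    exact ⟨w', hw, ih h⟩

theorem sat_boxes (n : ℕ) (φ : ModalFormula) (w : W) :
    Sat R v (boxes n φ) w ↔ ∀ u, IterRel R n w u → Sat R v φ u := by
  induction n generalizing w with
  | zero => simp [boxes, IterRel]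
  | succ n ih =>
    simp only [boxes, sat_box, ih, IterRel]
    exact ⟨fun h u ⟨w', h1, h2⟩ => h w' h1 u h2, fun h w' h1 u h2 => h u ⟨w', h1, h2⟩⟩

theorem sat_subst (s : ℕ → ModalFormula) (φ : ModalFormula) (w : W) :
    Sat R v (φ.subst s) w ↔ Sat R (fun i u => Sat R v (s i) u) φ w := by
  induction φ generalizing w with
  | var i => rfl
  | bot => rfl
  | and φ ψ h1 h2 => simp only [subst, Sat, h1, h2]
  | or φ ψ h1 h2 => simp only [subst, Sat, h1, h2]
  | imp φ ψ h1 h2 => simp only [subst, Sat, h1, h2]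
  | box φ h => simp only [subst, Sat, h]

end Sat

/-! ### Soundness of `wGrz`, and unique readability. -/

/-- A transitive frame whose strict part is conversely well-founded validates the axiom of
`wGrz`. -/
theorem sat_wGrzAxiom {W : Type} {R : W → W → Prop}
    (htrans : ∀ a b c, R a b → R b c → R a c) (hwf : WellFounded fun u w => R w u ∧ u ≠ w)
    (v : ℕ → W → Prop) (w : W) : Sat R v wGrzAxiom w := by
  simp only [wGrzAxiom, boxPlus, sat_imp, sat_and, sat_box]
  rintro ⟨h0, h1⟩
  have key : ∀ u, (u = w ∨ R w u) → Sat R v (var 0) u := by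
    intro u
    induction u using hwf.induction with
    | _ u ih =>
      intro hu
      have hup : ∀ y, R u y → y ≠ u → Sat R v (var 0) y := fun y hy hne =>
        ih y ⟨hy, hne⟩ (Or.inr (hu.elim (fun h => h ▸ hy) fun h => htrans _ _ _ h hy))
      have hmain : (∀ a, R u a → Sat R v (var 0) a → ∀ b, R a b → Sat R v (var 0) b) →
          Sat R v (var 0) u := by
        rcases hu with rfl | hu
        · exact h0
        · exact h1 u hu
      refine hmain fun a ha hpa b hb => ?_
      -- A successor of `a` other than `u` is covered by the induction hypothesis. If `a` leads back
      -- to `u`, then either `a = u`, where truth is already assumed, or there is a proper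
      -- two-cycle, contradicting well-foundedness.
      by_cases hbu : b = u
      · subst hbu
        by_cases hab : a = b
        · exact hab ▸ hpa
        · exact absurd ⟨ha, hab⟩ (hwf.asymmetric (a := b) (b := a) ⟨hb, Ne.symm hab⟩)
      · exact hup b (htrans _ _ _ ha hb) hbu
  exact key w (Or.inl rfl)

/-- Soundness of `wGrz`. -/
theorem sat_of_mem_logicWGrz {W : Type} {R : W → W → Prop}
    (htrans : ∀ a b c, R a b → R b c → R a c) (hwf : WellFounded fun u w => R w u ∧ u ≠ w)
    {φ : ModalFormula} (h : φ ∈ logicWGrz) (v : ℕ → W → Prop) (w : W) : Sat R v φ w := by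
  have h' : Oplus logicK wGrzAxiom φ := h
  clear h
  induction h' generalizing v w with
  | base h => exact h W R v w
  | axm => exact sat_wGrzAxiom htrans hwf v w
  | mp _ _ h1 h2 => exact h1 v w (h2 v w)
  | nec _ h => exact fun u _ => h v u
  | subst s _ h => exact (sat_subst R v s _ w).2 (h _ w)

/-- Unique readability, for variable-free formulas. -/
theorem word_append_inj {φ ψ : ModalFormula} (hφ : φ.IsConstant) (hψ : ψ.IsConstant)
    {a b : List Symbol} (h : φ.word ++ a = ψ.word ++ b) : φ = ψ ∧ a = b := by
  induction φ generalizing ψ a b with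
  | var i => exact hφ.elim
  | bot => cases ψ <;> simp_all [word, IsConstant]
  | box φ ih =>
    cases ψ <;> simp only [word, IsConstant, List.cons_append, List.cons.injEq, reduceCtorEq,
      false_and, true_and] at h hψ
    obtain ⟨rfl, rfl⟩ := ih hφ hψ h
    exact ⟨rfl, rfl⟩
  | and φ₁ φ₂ ih1 ih2 | or φ₁ φ₂ ih1 ih2 | imp φ₁ φ₂ ih1 ih2 =>
    cases ψ <;> simp only [word, IsConstant, List.cons_append, List.cons.injEq, reduceCtorEq,
      false_and, true_and, List.append_assoc] at h hψ
    obtain ⟨rfl, h'⟩ := ih1 hφ.1 hψ.1 h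
    obtain ⟨rfl, rfl⟩ := ih2 hφ.2 hψ.2 h'
    exact ⟨rfl, rfl⟩

theorem word_injective_of_isConstant {φ ψ : ModalFormula} (hφ : φ.IsConstant)
    (hψ : ψ.IsConstant) (h : φ.word = ψ.word) : φ = ψ :=
  (word_append_inj hφ hψ (a := []) (b := []) (by rw [h])).1

theorem isConstant_boxes (n : ℕ) {φ : ModalFormula} (h : φ.IsConstant) :
    (boxes n φ).IsConstant := by
  induction n with
  | zero => exact h
  | succ n ih => exact ih

end ModalFormula

/-! ### A frame for the weak Grzegorczyk logic -/

open ModalFormula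

/-- The points of the frame: the nodes of a binary tree (the `i`-th node at height `j`), gadget
points, an infinite descending chain of irreflexive points, and a reflexive point. -/
inductive TreeWorld : Type
  | node (j i : ℕ)
  | gadget (m : ℕ)
  | chain (k : ℕ)
  | loop

namespace TreeWorld

variable (s : ℕ) (Own : ℕ → ℕ → ℕ → Prop)

/-- The `m`-th gadget is visible from the `i`-th node at height `j`, if it belongs to a node at or
above it. -/
def Vis (j i m : ℕ) : Prop :=
  ∃ j' i', j ≤ j' ∧ j' ≤ s ∧ i' / 2 ^ (j' - j) = i ∧ Own j' i' m

/-- The accessibility relation. -/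
def Rel : TreeWorld → TreeWorld → Prop
  | node j i, node j' i' => j < j' ∧ j' ≤ s ∧ i' / 2 ^ (j' - j) = i
  | node j i, gadget m => Vis s Own j i m
  | node _ _, chain _ => True
  | node _ _, loop => True
  | gadget m, chain k => k ≤ m
  | gadget _, loop => True
  | chain k, chain k' => k' < k
  | loop, loop => True
  | _, _ => False

theorem div_pow_trans {a b c i i' i'' : ℕ} (hab : a ≤ b) (hbc : b ≤ c)
    (h1 : i' / 2 ^ (b - a) = i) (h2 : i'' / 2 ^ (c - b) = i') : i'' / 2 ^ (c - a) = i := by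
  rw [← h1, ← h2, Nat.div_div_eq_div_mul, ← pow_add]
  congr 2
  omega

/-- Visibility of gadgets is inherited from descendants by the definition of `Vis`; this is exactly
what transitivity costs. -/
theorem rel_trans {a b c : TreeWorld} (h1 : Rel s Own a b) (h2 : Rel s Own b c) :
    Rel s Own a c := by
  cases a <;> cases b <;> cases c <;> simp only [Rel] at h1 h2 ⊢
  · exact ⟨h1.1.trans h2.1, h2.2.1, div_pow_trans h1.1.le h2.1.le h1.2.2 h2.2.2⟩
  · obtain ⟨j', i', hj, hs, hi, ho⟩ := h2
    exact ⟨j', i', h1.1.le.trans hj, hs, div_pow_trans h1.1.le hj h1.2.2 hi, ho⟩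
  all_goals omega

/-- The rank of a point. -/
def rank : TreeWorld → ℕ ×ₗ ℕ
  | node j _ => toLex (2 + (s - j), 0)
  | gadget _ => toLex (1, 0)
  | chain k => toLex (0, k)
  | loop => toLex (0, 0)

/-- A node sees the whole infinite chain, hence the lexicographic rank. The only reflexive point is
`loop`, which the strict part ignores. -/
theorem rel_wf : WellFounded fun u w => Rel s Own w u ∧ u ≠ w := by
  refine Subrelation.wf (r := InvImage (· < ·) (rank s)) (fun {u w} h => ?_)
    (InvImage.wf _ wellFounded_lt)
  obtain ⟨h, hne⟩ := h
  cases w <;> cases u <;> simp only [Rel] at h <;>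
    simp only [InvImage, rank, Prod.Lex.toLex_lt_toLex] <;>
    first | omega | exact Or.inr ⟨trivial, h⟩ | exact absurd rfl hne

variable (v : ℕ → TreeWorld → Prop)

theorem sat_boxes_chain (n k : ℕ) : Sat (Rel s Own) v (boxes n bot) (chain k) ↔ k < n := by
  induction n generalizing k with
  | zero => simp [boxes]
  | succ n ih =>
    simp only [boxes, sat_box]
    constructor
    · intro h
      by_contra hk
      have := (ih n).1 (h (chain n) (by simp only [Rel]; omega))
      omega
    · intro h u hu
      cases u <;> simp only [Rel] at hu
      exact (ih _).2 (by omega)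

theorem sat_boxes_loop (n : ℕ) : ¬ Sat (Rel s Own) v (boxes n bot) loop := by
  induction n with
  | zero => simp [boxes]
  | succ n ih => exact fun h => ih (h loop trivial)

theorem not_sat_boxes_of_rel_loop {w : TreeWorld} (hw : Rel s Own w loop) (n : ℕ) :
    ¬ Sat (Rel s Own) v (boxes n bot) w := by
  cases n with
  | zero => simp [boxes]
  | succ n => exact fun h => sat_boxes_loop s Own v n (h loop hw)

/-- Every point outside the chain sees `loop`, where no iterated box of `⊥` holds; on the chain the
number of boxes measures the depth. -/
theorem sat_chainF (m : ℕ) (w : TreeWorld) :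
    Sat (Rel s Own) v (chainF m) w ↔ w = chain m := by
  simp only [chainF, sat_and, sat_neg]
  cases w with
  | chain k => simp only [sat_boxes_chain, chain.injEq]; omega
  | _ =>
    simp only [reduceCtorEq, iff_false, not_and]
    exact fun h => absurd h (not_sat_boxes_of_rel_loop s Own v (by trivial) _)

/-- Every other point is the dead end `chain 0` or sees it. -/
theorem sat_serialF_iff (w : TreeWorld) : Sat (Rel s Own) v serialF w ↔ w = loop := by
  simp only [serialF, sat_and, sat_dia, sat_neg, sat_box, sat_bot, not_false_eq_true, and_true]
  have hdead : ¬ ∃ u, Rel s Own (chain 0) u := by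
    rintro ⟨u, hu⟩
    cases u <;> simp [Rel] at hu
  constructor
  · rintro ⟨⟨u, hu⟩, h⟩
    cases w with
    | loop => rfl
    | node j i => exact absurd (h (chain 0) trivial) hdead
    | gadget m => exact absurd (h (chain 0) (Nat.zero_le _)) hdead
    | chain k =>
      cases u <;> simp only [Rel] at hu
      exact absurd (h (chain 0) (by simp only [Rel]; omega)) hdead
  · rintro rfl
    refine ⟨⟨loop, trivial⟩, fun u hu => ?_⟩
    cases u <;> simp only [Rel] at hu
    exact ⟨loop, trivial⟩

/-- Nodes are excluded because they see `chain (m + 1)`, and `chain (m + 1)` itself, which also has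
`chain m` as its top visible chain point, because it does not see `loop`. -/
theorem sat_gadgetF_iff (m : ℕ) (w : TreeWorld) :
    Sat (Rel s Own) v (gadgetF m) w ↔ w = gadget m := by
  simp only [gadgetF, sat_and, sat_neg, sat_dia, sat_chainF, sat_serialF_iff, exists_eq_right]
  cases w <;> simp only [Rel, gadget.injEq] <;> simp
  omega

theorem sat_atomF_iff (m : ℕ) (w : TreeWorld) :
    Sat (Rel s Own) v (atomF m) w ↔ ∃ j i, w = node j i ∧ Vis s Own j i m := by
  simp only [atomF, sat_dia, sat_gadgetF_iff, exists_eq_right]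
  cases w <;> simp [Rel]

end TreeWorld

/-! ### Runs of a space-bounded machine and the time at which they halt. -/

namespace SpaceMachine

variable {α : Type} (M : SpaceMachine α)

/-- One step of the computation; a halted configuration is repeated. -/
def next (c : M.Cfg) : M.Cfg := (M.step c).getD c

/-- The configuration after `t` steps on the input `x`. -/
def run (x : List α) (t : ℕ) : M.Cfg := M.next^[t] (M.init x)

theorem run_succ (x : List α) (t : ℕ) : M.run x (t + 1) = M.next (M.run x t) :=
  Function.iterate_succ_apply' _ _ _

theorem reaches_run (x : List α) (t : ℕ) :
    StateTransition.Reaches M.step (M.init x) (M.run x t) := by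
  induction t with
  | zero => exact Relation.ReflTransGen.refl
  | succ t ih =>
    rw [run_succ]
    cases h : M.step (M.run x t) with
    | none => simpa only [next, h, Option.getD_none] using ih
    | some c => exact ih.tail (by simp [next, h])

theorem run_eq_of_le {x : List α} {t t' : ℕ} (h : M.step (M.run x t) = none) (ht : t ≤ t') :
    M.run x t' = M.run x t := by
  induction t', ht using Nat.le_induction with
  | base => rfl
  | succ n _ ih => rw [run_succ, ih, next, h, Option.getD_none]

theorem exists_run_of_reaches {x : List α} {c : M.Cfg}
    (h : StateTransition.Reaches M.step (M.init x) c) : ∃ t, M.run x t = c := by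
  induction h with
  | refl => exact ⟨0, rfl⟩
  | tail _ h ih =>
    obtain ⟨t, rfl⟩ := ih
    refine ⟨t + 1, ?_⟩
    rw [run_succ, next, Option.mem_def.1 h, Option.getD_some]

variable {M}

/-- Cells never scanned are never written. A configuration of the run is therefore determined by
finite data: state, head and the first `m` cells. -/
theorem run_tape_of_le {x : List α} {m : ℕ} (hm : M.RunsInSpace x m) (t : ℕ) {p : ℕ}
    (hp : m ≤ p) : (M.run x t).tape p = (M.init x).tape p := by
  induction t with
  | zero => rfl
  | succ t ih =>
    rw [run_succ, ← ih, next]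
    have hne : p ≠ (M.run x t).head := by
      have := hm _ (M.reaches_run x t)
      omega
    simp only [step]
    cases M.δ (M.run x t).state ((M.run x t).tape (M.run x t).head) with
    | none => rfl
    | some r => exact Function.update_of_ne hne _ _

/-- A machine that halts within bounded space halts before it can repeat a configuration. -/
theorem step_run_eq_none {A : Language α} (hA : M.Decides A) {x : List α} {m N : ℕ}
    (hm : M.RunsInSpace x m) (hN : Nat.card M.Q * (m * Nat.card M.Γ ^ m) ≤ N) :
    M.step (M.run x N) = none := by
  classical
  have := M.finQ
  have := M.finΓ
  by_contra hne
  have hhead : ∀ t, (M.run x t).head < m := fun t => hm _ (M.reaches_run x t)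
  let F : Fin (N + 1) → M.Q × (Fin m × (Fin m → M.Γ)) := fun t =>
    ((M.run x t).state, ⟨(M.run x t).head, hhead t⟩, fun p => (M.run x t).tape p)
  -- Pigeonhole: there are `N + 1` times but at most `N` possible values.
  have hnot : ¬ Function.Injective F := by
    intro hF
    have h := Nat.card_le_card_of_injective F hF
    rw [Nat.card_prod, Nat.card_prod, Nat.card_fun, Nat.card_fin, Nat.card_fin] at h
    omega
  have key : ∀ i j : ℕ, i < j → i ≤ N → (M.run x i).state = (M.run x j).state →
      (M.run x i).head = (M.run x j).head →
      (∀ p < m, (M.run x i).tape p = (M.run x j).tape p) → False := by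
    intro i j hij hi h1 h2 h3
    have heq : M.run x i = M.run x j := by
      cases hi' : M.run x i with
      | mk q h τ =>
        cases hj' : M.run x j with
        | mk q' h' τ' =>
          simp only [hi', hj'] at h1 h2 h3
          subst h1 h2
          congr 1
          funext p
          by_cases hp : p < m
          · exact h3 p hp
          · have e1 := run_tape_of_le hm i (not_lt.1 hp)
            have e2 := run_tape_of_le hm j (not_lt.1 hp)
            rw [hi'] at e1
            rw [hj'] at e2
            exact e1.trans e2.symm
    -- A repetition makes the run periodic. Going through enough periods to pass the halting time
    -- shows that configuration `i` was already halted, and hence configuration `N`.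
    have hper : ∀ k, M.run x (i + k * (j - i)) = M.run x i := by
      intro k
      induction k with
      | zero => simp
      | succ k ih =>
        have e : i + (k + 1) * (j - i) = k * (j - i) + j := by
          rw [Nat.succ_mul]; omega
        rw [e, run, Function.iterate_add_apply]
        change M.next^[k * (j - i)] (M.run x j) = _
        rw [← heq, run, ← Function.iterate_add_apply, Nat.add_comm]
        exact ih
    obtain ⟨c, hc, -⟩ := hA x
    obtain ⟨hreach, hhalt⟩ := StateTransition.mem_eval.1 hc
    obtain ⟨t, rfl⟩ := M.exists_run_of_reaches hreach
    have ht : t ≤ i + t * (j - i) := by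
      have : t * 1 ≤ t * (j - i) := Nat.mul_le_mul_left _ (by omega)
      omega
    have h4 := M.run_eq_of_le hhalt ht
    rw [hper] at h4
    rw [← h4] at hhalt
    exact hne (M.run_eq_of_le hhalt hi ▸ hhalt)
  simp only [Function.Injective, not_forall] at hnot
  obtain ⟨i, j, hF, hij⟩ := hnot
  simp only [F, Prod.mk.injEq, Fin.mk.injEq] at hF
  have hv : (i : ℕ) ≠ j := fun h => hij (Fin.ext h)
  have htape : ∀ p < m, (M.run x i).tape p = (M.run x j).tape p := fun p hp =>
    congrFun hF.2.2 ⟨p, hp⟩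
  rcases lt_or_gt_of_ne hv with h | h
  · exact key i j h (by omega) hF.1 hF.2.1 htape
  · exact key j i h (by omega) hF.1.symm hF.2.1.symm fun p hp => (htape p hp).symm

theorem mem_iff_of_decides {A : Language α} (hA : M.Decides A) {x : List α} {N : ℕ}
    (hN : M.step (M.run x N) = none) : (M.run x N).state ∈ M.accept ↔ x ∈ A := by
  obtain ⟨c, hc, h⟩ := hA x
  have h' := StateTransition.mem_eval.2 ⟨M.reaches_run x N, hN⟩
  rwa [Part.mem_unique h' hc]

/-- The elementary facts about a configuration: a pair of the head position and the state, or
the contents of a cell. -/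
inductive Fact (M : SpaceMachine α) : Type
  | head (q : M.Q)
  | cell (γ : M.Γ)

/-- The fact `f` holds at the position `p` of the configuration `c`. -/
def Fact.Holds (c : M.Cfg) : M.Fact → ℕ → Prop
  | .head q, p => c.state = q ∧ c.head = p
  | .cell γ, p => c.tape p = γ

theorem Fact.finite : Finite M.Fact := by
  have := M.finQ
  have := M.finΓ
  refine Finite.of_injective (β := M.Q ⊕ M.Γ)
    (fun | .head q => Sum.inl q | .cell γ => Sum.inr γ) ?_
  rintro (_ | _) (_ | _) h <;> simp_all

end SpaceMachine

/-- Each of `a`, `m`, `b` is below its own power of two. With the cardinalities inserted, the left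
side bounds the number of configurations, so a tree of depth `s` covers the whole run. -/
theorem card_mul_le_two_pow (a b m s : ℕ) (hs : a + m * (b + 1) ≤ s) :
    a * (m * b ^ m) ≤ 2 ^ s := by
  calc a * (m * b ^ m) ≤ 2 ^ a * (2 ^ m * (2 ^ b) ^ m) := by
        gcongr <;> exact Nat.lt_two_pow_self.le
    _ = 2 ^ (a + m * (b + 1)) := by
        rw [← pow_mul, ← pow_add, ← pow_add]; congr 1; ring
    _ ≤ 2 ^ s := Nat.pow_le_pow_right (by norm_num) hs

/-! ### Formula templates -/

/-- The parameters of a formula template: three loop indices `j`, `p`, `d`, an input position `n`,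
and the bound `s` on the loop indices. -/
inductive LoopVar : Type
  | j
  | p
  | d
  | n
  | s
  deriving DecidableEq

instance : Fintype LoopVar := ⟨{.j, .p, .d, .n, .s}, fun x => by cases x <;> decide⟩

/-- The monomials `c`, `c·r` and `c·r·(s+2)`, where `r` is a parameter. -/
inductive Mono : Type
  | const (c : ℕ)
  | lin (r : LoopVar) (c : ℕ)
  | quad (r : LoopVar) (c : ℕ)

/-- The value of a monomial. -/
def Mono.eval (e : LoopVar → ℕ) : Mono → ℕ
  | const c => c
  | lin r c => c * e r
  | quad r c => c * (e r * (e .s + 2))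

/-- The value of a sum of monomials. -/
def evalSum (e : LoopVar → ℕ) (N : List Mono) : ℕ := (N.map (Mono.eval e)).sum

/-- Formulas with iterated boxes, where the numbers of boxes depend on the parameters. -/
inductive Template : Type
  | bot
  | and (a b : Template)
  | imp (a b : Template)
  | boxes (N : List Mono) (a : Template)

namespace Template

/-- The value of a template. -/
def eval (e : LoopVar → ℕ) : Template → ModalFormula
  | bot => .bot
  | and a b => .and (a.eval e) (b.eval e)
  | imp a b => .imp (a.eval e) (b.eval e)
  | boxes N a => ModalFormula.boxes (evalSum e N) (a.eval e)

theorem isConstant_eval (e : LoopVar → ℕ) (t : Template) : (t.eval e).IsConstant := by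
  induction t with
  | bot => trivial
  | and a b h1 h2 => exact ⟨h1, h2⟩
  | imp a b h1 h2 => exact ⟨h1, h2⟩
  | boxes N a h => exact isConstant_boxes _ h

/-- Negation. -/
def neg (a : Template) : Template := imp a bot

/-- Necessity. -/
def box (a : Template) : Template := boxes [.const 1] a

/-- Possibility. -/
def dia (a : Template) : Template := neg (box (neg a))

@[simp] theorem eval_neg (e : LoopVar → ℕ) (a : Template) :
    (neg a).eval e = ModalFormula.neg (a.eval e) := rfl

@[simp] theorem eval_box (e : LoopVar → ℕ) (a : Template) :
    (box a).eval e = ModalFormula.box (a.eval e) := rfl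

@[simp] theorem eval_dia (e : LoopVar → ℕ) (a : Template) :
    (dia a).eval e = ModalFormula.dia (a.eval e) := rfl

/-- The template of `chainF`. -/
def chain (N : List Mono) : Template := and (boxes (.const 1 :: N) bot) (neg (boxes N bot))

/-- The template of `serialF`. -/
def serial : Template := and (dia (neg bot)) (box (dia (neg bot)))

/-- The template of `atomF`. -/
def atom (N : List Mono) : Template :=
  dia (and (dia (chain N)) (and (neg (dia (chain (.const 1 :: N)))) (dia serial)))

theorem eval_atom (e : LoopVar → ℕ) (N : List Mono) :
    (atom N).eval e = atomF (evalSum e N) := by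
  have h1 : evalSum e (.const 1 :: N) = evalSum e N + 1 := by
    simp [evalSum, Mono.eval, Nat.add_comm]
  have h2 : evalSum e (.const 1 :: .const 1 :: N) = evalSum e N + 1 + 1 := by
    simp [evalSum, Mono.eval]; omega
  simp only [atom, chain, eval_dia, eval, eval_neg, h1, h2]
  rfl

end Template

/-- An expression `r + c`, or a sum of several parameters and a constant. -/
structure Affine : Type where
  vars : List LoopVar
  const : ℕ

namespace Affine

/-- The value of the expression. -/
def eval (e : LoopVar → ℕ) (a : Affine) : ℕ := (a.vars.map e).sum + a.const

/-- A constant. -/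
def ofNat (c : ℕ) : Affine := ⟨[], c⟩

/-- A parameter. -/
def var (r : LoopVar) : Affine := ⟨[r], 0⟩

/-- The successor. -/
def succ (a : Affine) : Affine := ⟨a.vars, a.const + 1⟩

@[simp] theorem eval_ofNat (e : LoopVar → ℕ) (c : ℕ) : (ofNat c).eval e = c := by
  simp [eval, ofNat]

@[simp] theorem eval_var (e : LoopVar → ℕ) (r : LoopVar) : (var r).eval e = e r := by
  simp [eval, var]

@[simp] theorem eval_succ (e : LoopVar → ℕ) (a : Affine) : a.succ.eval e = a.eval e + 1 := rfl

end Affine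

/-- The number of the variable of the kind `τ < T` with level `l < s + 2` and position `p`. -/
def atomIdx (T s l τ p : ℕ) : ℕ := T * (p * (s + 2) + l) + τ

/-- Mixed-radix digits: `τ` modulo `T`, then `l` modulo `s + 2`. The level digit must reach `s + 1`,
since being a node of level `s` is expressed with the level marker `s + 1`. -/
theorem atomIdx_inj {T s l τ p l' τ' p' : ℕ} (hl : l < s + 2) (hl' : l' < s + 2) (hτ : τ < T)
    (hτ' : τ' < T) (h : atomIdx T s l τ p = atomIdx T s l' τ' p') :
    l = l' ∧ τ = τ' ∧ p = p' := by
  unfold atomIdx at h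
  have hT : 0 < T := by omega
  have h1 : τ = τ' := by
    have := congrArg (· % T) h
    simpa [Nat.mod_eq_of_lt hτ, Nat.mod_eq_of_lt hτ'] using this
  subst h1
  have h2 : p * (s + 2) + l = p' * (s + 2) + l' := Nat.eq_of_mul_eq_mul_left hT (by omega)
  have h3 : l = l' := by
    have := congrArg (· % (s + 2)) h2
    simpa [Nat.mod_eq_of_lt hl, Nat.mod_eq_of_lt hl'] using this
  subst h3
  exact ⟨rfl, rfl, Nat.eq_of_mul_eq_mul_right (by omega : 0 < s + 2) (by omega)⟩

/-- The template of the variable of kind `τ` with the given level and position. -/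
def varT (T : ℕ) (l : Affine) (τ : ℕ) (p : Affine) : Template :=
  .atom (p.vars.map (.quad · T) ++ .lin .s (T * p.const) :: .const (2 * T * p.const) ::
    (l.vars.map (.lin · T) ++ [.const (T * l.const + τ)]))

theorem sum_map_mul_left (c : ℕ) (f : LoopVar → ℕ) (l : List LoopVar) :
    (l.map fun r => c * f r).sum = c * (l.map f).sum := by
  induction l with
  | nil => simp
  | cons a l ih => simp [ih, Nat.mul_add]

-- The constant part of the position is multiplied by `s + 2`, which is why it contributes both a
-- term linear in `s` and twice itself as a constant.
@[simp] theorem eval_varT (T : ℕ) (l : Affine) (τ : ℕ) (p : Affine) (e : LoopVar → ℕ) :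
    (varT T l τ p).eval e = atomF (atomIdx T (e .s) (l.eval e) τ (p.eval e)) := by
  rw [varT, Template.eval_atom]
  congr 1
  have h1 : ∀ L : List LoopVar, (L.map fun r => T * (e r * (e .s + 2))).sum =
      T * ((L.map e).sum * (e .s + 2)) := by
    intro L
    rw [sum_map_mul_left T fun r => e r * (e .s + 2)]
    simp only [Nat.mul_comm _ (e .s + 2)]
    rw [sum_map_mul_left]
  simp only [evalSum, List.map_append, List.map_map, List.map_cons, List.map_nil,
    List.sum_append, List.sum_cons, List.sum_nil, Function.comp_def, Mono.eval, h1,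
    sum_map_mul_left, atomIdx, Affine.eval]
  ring

/-! ### The formula describing a computation -/

namespace SpaceMachine

variable {α : Type} (M : SpaceMachine α)

/-- The number of facts. -/
noncomputable def numFacts : ℕ := Nat.card M.Fact

/-- A numbering of the facts. -/
noncomputable def factCode (f : M.Fact) : ℕ := by
  have := Fact.finite (M := M)
  exact (Finite.equivFin M.Fact f : ℕ)

variable {M}

theorem factCode_lt (f : M.Fact) : M.factCode f < M.numFacts := Fin.is_lt _

theorem factCode_injective : Function.Injective M.factCode := by
  have := Fact.finite (M := M)
  exact fun f g h => (Finite.equivFin M.Fact).injective (Fin.ext h)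

variable (M)

/-- The number of kinds of variables. -/
noncomputable def numKinds : ℕ := 2 + 3 * M.numFacts

/-- The kind of the variable for the fact `f` of the configuration number `v < 3`. -/
noncomputable def kind (v : ℕ) (f : M.Fact) : ℕ := 2 + 3 * M.factCode f + v

variable {M} in
theorem kind_lt {v : ℕ} (hv : v < 3) (f : M.Fact) : M.kind v f < M.numKinds := by
  have := factCode_lt f
  unfold kind numKinds
  omega

variable {M} in
theorem kind_inj {v v' : ℕ} (hv : v < 3) (hv' : v' < 3) {f f' : M.Fact}
    (h : M.kind v f = M.kind v' f') : v = v' ∧ f = f' := by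
  unfold kind at h
  exact ⟨by omega, factCode_injective (by omega)⟩

/-- The fact `f` at position `p` for the configuration number `v` at level `l`. -/
noncomputable def factT (v : ℕ) (f : M.Fact) (l p : Affine) : Template :=
  varT M.numKinds l (M.kind v f) p

/-- "This is a node of level `l`." -/
noncomputable def levelT (l : Affine) : Template :=
  .and (varT M.numKinds l.succ 0 (.ofNat 0)) (.neg (varT M.numKinds l 0 (.ofNat 0)))

/-- "This is a second child", at level `j + 1`. -/
noncomputable def secondT : Template :=
  varT M.numKinds (Affine.var .j).succ 1 (.ofNat 0)

/-- `φ` holds at the nodes of level `r`. -/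
noncomputable def guardT (r : LoopVar) (φ : Template) : Template :=
  .boxes [.lin r 1] (.imp (M.levelT (.var r)) φ)

/-- `φ` holds at those children of a node of level `j` that satisfy `b`. -/
noncomputable def childT (b φ : Template) : Template :=
  .box (.imp (M.levelT (Affine.var .j).succ) (.imp b φ))

/-- The pieces of local information about the computation: if the first two facts hold in a
configuration, then the third one holds in the next configuration. -/
structure LocalRule : Type where
  fact₁ : M.Fact
  pos₁ : Affine
  fact₂ : M.Fact
  pos₂ : Affine
  fact₃ : M.Fact
  pos₃ : Affine

variable {M}

/-- The local rules for the state `q` and the scanned symbol `γ`. -/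
def scanRules (q : M.Q) (γ : M.Γ) : List M.LocalRule :=
  let p := Affine.var .p
  match M.δ q γ with
  | none => [⟨.head q, p, .cell γ, p, .head q, p⟩, ⟨.head q, p, .cell γ, p, .cell γ, p⟩]
  | some (q', γ', .right) =>
    [⟨.head q, p, .cell γ, p, .head q', p.succ⟩, ⟨.head q, p, .cell γ, p, .cell γ', p⟩]
  | some (q', γ', .left) =>
    [⟨.head q, p.succ, .cell γ, p.succ, .head q', p⟩,
      ⟨.head q, .ofNat 0, .cell γ, .ofNat 0, .head q', .ofNat 0⟩,
      ⟨.head q, p, .cell γ, p, .cell γ', p⟩]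

/-- The local rules saying that only the scanned cell changes. -/
def frameRules (q : M.Q) (γ : M.Γ) : List M.LocalRule :=
  let p := Affine.var .p
  let p' : Affine := ⟨[.p, .d], 1⟩
  [⟨.head q, p, .cell γ, p', .cell γ, p'⟩, ⟨.head q, p', .cell γ, p, .cell γ, p⟩]

/-- The template of a local rule. -/
noncomputable def LocalRule.toTemplate (ρ : M.LocalRule) : Template :=
  M.guardT .s (.imp (M.factT 0 ρ.fact₁ (.var .s) ρ.pos₁)
    (.imp (M.factT 0 ρ.fact₂ (.var .s) ρ.pos₂) (M.factT 1 ρ.fact₃ (.var .s) ρ.pos₃)))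

/-- The templates relating the configurations of a node of level `j` to those of its children. -/
noncomputable def copyTemplates (f : M.Fact) : List Template :=
  let l := Affine.var .j
  let p := Affine.var .p
  [M.guardT .j (.imp (M.factT 0 f l p) (M.childT (.neg M.secondT) (M.factT 0 f l.succ p))),
    M.guardT .j (.imp (M.factT 2 f l p) (M.childT M.secondT (M.factT 0 f l.succ p))),
    M.guardT .j (.imp (.neg (M.factT 2 f l p))
      (M.childT (.neg M.secondT) (.neg (M.factT 1 f l.succ p)))),
    M.guardT .j (.imp (.neg (M.factT 1 f l p))
      (M.childT M.secondT (.neg (M.factT 1 f l.succ p))))]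

variable (M)

/-- The templates that do not depend on the machine. -/
noncomputable def treeTemplates : List Template :=
  let l := (Affine.var .j).succ
  [M.levelT (.ofNat 0),
    M.guardT .j (.dia (.and (M.levelT l) (.neg M.secondT))),
    M.guardT .j (.dia (.and (M.levelT l) M.secondT)),
    M.factT 0 (.head M.start) (.ofNat 0) (.ofNat 0),
    M.factT 0 (.cell M.blank) (.ofNat 0) ⟨[.n, .d], 0⟩]

/-- The template saying that the final configuration is not accepting. -/
noncomputable def rejectTemplate (q : M.Q) : Template :=
  .neg (M.factT 1 (.head q) (.ofNat 0) (.var .p))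

/-- The template for an input letter. -/
noncomputable def letterTemplate (a : α) : Template :=
  M.factT 0 (.cell (M.letter a)) (.ofNat 0) (.var .n)

/-- The set of all the templates that do not depend on the input. -/
def templateSet : Set Template :=
  {t | t ∈ M.treeTemplates ∨ (∃ f : M.Fact, t ∈ copyTemplates f) ∨
    (∃ q ∈ M.accept, t = M.rejectTemplate q) ∨
    ∃ (q : M.Q) (γ : M.Γ), ∃ ρ ∈ scanRules q γ ++ frameRules q γ, t = ρ.toTemplate}

/-- The templates depend on the machine only, so all of them can be built into the program that
computes the reduction. -/
theorem finite_templateSet : M.templateSet.Finite := by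
  have := M.finQ
  have := M.finΓ
  have := Fact.finite (M := M)
  refine (List.finite_toSet _).union (.union ?_ (.union ?_ ?_))
  · exact (Set.finite_iUnion fun f : M.Fact => List.finite_toSet (copyTemplates f)).subset
      fun t ⟨f, hf⟩ => Set.mem_iUnion.2 ⟨f, hf⟩
  · exact ((Set.toFinite M.accept).image M.rejectTemplate).subset
      fun t ⟨q, hq, h⟩ => ⟨q, hq, h.symm⟩
  · refine (Set.finite_iUnion fun q : M.Q => Set.finite_iUnion fun γ : M.Γ =>
      (List.finite_toSet (scanRules q γ ++ frameRules q γ)).image LocalRule.toTemplate).subset ?_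
    rintro t ⟨q, γ, ρ, hρ, h⟩
    exact Set.mem_iUnion.2 ⟨q, Set.mem_iUnion.2 ⟨γ, ρ, hρ, h.symm⟩⟩

/-- The values of the parameters. -/
def paramEnv (j p d n s : ℕ) : LoopVar → ℕ
  | .j => j
  | .p => p
  | .d => d
  | .n => n
  | .s => s

/-- The conjuncts of the formula describing the computation of `M` on the input `x`. -/
def conjuncts (x : List α) (s : ℕ) : Set ModalFormula :=
  {φ | (∃ t ∈ M.templateSet, ∃ j < s, ∃ p < s, ∃ d < s, φ = t.eval (paramEnv j p d x.length s)) ∨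
    ∃ (k : ℕ) (hk : k < x.length), φ = (M.letterTemplate x[k]).eval (paramEnv 0 0 0 k s)}

section Unsat

variable {W : Type} (R : W → W → Prop) (v : ℕ → W → Prop)

/-- The truth of the variable of kind `τ` with level `l` and position `p`. -/
def VarAt (s l τ p : ℕ) (w : W) : Prop := Sat R v (atomF (atomIdx M.numKinds s l τ p)) w

/-- "The point `w` is a node of level `l`." -/
def LevelAt (s l : ℕ) (w : W) : Prop := M.VarAt R v s (l + 1) 0 0 w ∧ ¬ M.VarAt R v s l 0 0 w

theorem sat_factT (e : LoopVar → ℕ) (i : ℕ) (f : M.Fact) (l p : Affine) (w : W) :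
    Sat R v ((M.factT i f l p).eval e) w ↔
      M.VarAt R v (e .s) (l.eval e) (M.kind i f) (p.eval e) w := by
  rw [factT, eval_varT, VarAt]

theorem sat_levelT (e : LoopVar → ℕ) (l : Affine) (w : W) :
    Sat R v ((M.levelT l).eval e) w ↔ M.LevelAt R v (e .s) (l.eval e) w := by
  simp [levelT, Template.eval, VarAt, LevelAt]

theorem sat_secondT (e : LoopVar → ℕ) (w : W) :
    Sat R v (M.secondT.eval e) w ↔ M.VarAt R v (e .s) (e .j + 1) 1 0 w := by
  simp [secondT, VarAt]

/-- The frame need not be transitive here, so the number of boxes is the exact distance at which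
nodes of the level are constructed. In the transitive tree model further points are reached, and the
level guard filters them. -/
theorem sat_guardT (e : LoopVar → ℕ) (r : LoopVar) (φ : Template) (w : W) :
    Sat R v ((M.guardT r φ).eval e) w ↔
      ∀ u, IterRel R (e r) w u → M.LevelAt R v (e .s) (e r) u → Sat R v (φ.eval e) u := by
  simp [guardT, Template.eval, sat_boxes, evalSum, Mono.eval, sat_levelT]

theorem sat_childT (e : LoopVar → ℕ) (b φ : Template) (w : W) :
    Sat R v ((M.childT b φ).eval e) w ↔
      ∀ u, R w u → M.LevelAt R v (e .s) (e .j + 1) u → Sat R v (b.eval e) u →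
        Sat R v (φ.eval e) u := by
  simp [childT, Template.eval, sat_levelT]

/-- The configuration number `i` of the node `w` of level `l` contains all the facts about the
configuration `c` at positions below `s`. -/
def Contains (s l i : ℕ) (w : W) (c : M.Cfg) : Prop :=
  ∀ (f : M.Fact), ∀ p < s, f.Holds c p → M.VarAt R v s l (M.kind i f) p w

end Unsat

end SpaceMachine

/-! ### Every model of the conjuncts contains the run. -/

namespace SpaceMachine

variable {α : Type} {M : SpaceMachine α}

section Unsat

variable {W : Type} {R : W → W → Prop} {v : ℕ → W → Prop} {w₀ : W} {s n : ℕ}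

/-- Each fact about the next configuration follows from the head fact and one cell fact: the scan
rules treat the head and the scanned cell, the frame rules all other cells. -/
theorem contains_next_of_local
    (hS : ∀ t ∈ M.templateSet, ∀ j < s, ∀ p < s, ∀ d < s,
      Sat R v (t.eval (paramEnv j p d n s)) w₀)
    {w : W} (hw : IterRel R s w₀ w) (hl : M.LevelAt R v s s w) {c : M.Cfg} (hc : c.head < s)
    (h : M.Contains R v s s 0 w c) : M.Contains R v s s 1 w (M.next c) := by
  have hrule : ∀ (q : M.Q) (γ : M.Γ), ∀ ρ ∈ scanRules q γ ++ frameRules q γ, ∀ p < s, ∀ d < s,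
      ρ.fact₁.Holds c (ρ.pos₁.eval (paramEnv 0 p d n s)) →
      ρ.fact₂.Holds c (ρ.pos₂.eval (paramEnv 0 p d n s)) →
      ρ.pos₁.eval (paramEnv 0 p d n s) < s → ρ.pos₂.eval (paramEnv 0 p d n s) < s →
      M.VarAt R v s s (M.kind 1 ρ.fact₃) (ρ.pos₃.eval (paramEnv 0 p d n s)) w := by
    intro q γ ρ hρ p hp d hd h1 h2 h1' h2'
    have := hS ρ.toTemplate (Or.inr (Or.inr (Or.inr ⟨q, γ, ρ, hρ, rfl⟩))) 0 (by omega) p hp d hd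
    simp only [LocalRule.toTemplate, sat_guardT, Template.eval, sat_imp, sat_factT,
      Affine.eval_var] at this
    exact this w hw hl (h _ _ h1' h1) (h _ _ h2' h2)
  obtain ⟨q, hd, τ⟩ := c
  simp only at hc
  -- Two distinct positions have the form `p` and `p + d + 1` in one of the two orders, so `d` is
  -- their distance minus one.
  have hframe : ∀ p < s, p ≠ hd → M.VarAt R v s s (M.kind 1 (.cell (τ p))) p w := by
    intro p hp hne
    rcases lt_or_gt_of_ne hne with hlt | hgt
    · have e : p + (hd - p - 1) + 1 = hd := by omega
      have := hrule q (τ p) ⟨.head q, ⟨[.p, .d], 1⟩, .cell (τ p), .var .p, .cell (τ p), .var .p⟩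
        (by simp [frameRules]) p hp (hd - p - 1) (by omega)
      simp only [Affine.eval, Affine.var, List.map_cons, List.map_nil, List.sum_cons,
        List.sum_nil, paramEnv, Nat.add_zero, e, Fact.Holds, true_and, forall_const] at this
      exact this hc hp
    · have e : hd + (p - hd - 1) + 1 = p := by omega
      have := hrule q (τ p) ⟨.head q, .var .p, .cell (τ p), ⟨[.p, .d], 1⟩, .cell (τ p),
        ⟨[.p, .d], 1⟩⟩ (by simp [frameRules]) hd hc (p - hd - 1) (by omega)
      simp only [Affine.eval, Affine.var, List.map_cons, List.map_nil, List.sum_cons,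
        List.sum_nil, paramEnv, Nat.add_zero, e, Fact.Holds, true_and, forall_const] at this
      exact this hc hp
  have hscan : ∀ ρ ∈ scanRules q (τ hd), ∀ p < s, ρ.fact₁.Holds ⟨q, hd, τ⟩
      (ρ.pos₁.eval (paramEnv 0 p 0 n s)) → ρ.fact₂.Holds ⟨q, hd, τ⟩
      (ρ.pos₂.eval (paramEnv 0 p 0 n s)) →
      ρ.pos₁.eval (paramEnv 0 p 0 n s) < s → ρ.pos₂.eval (paramEnv 0 p 0 n s) < s →
      M.VarAt R v s s (M.kind 1 ρ.fact₃) (ρ.pos₃.eval (paramEnv 0 p 0 n s)) w :=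
    fun ρ hρ p hp => hrule q (τ hd) ρ (List.mem_append_left _ hρ) p hp 0 (by omega)
  cases hδ : M.δ q (τ hd) with
  | none =>
    have hnext : M.next ⟨q, hd, τ⟩ = ⟨q, hd, τ⟩ := by simp [next, step, hδ]
    simp only [scanRules, hδ, List.forall_mem_cons, List.not_mem_nil, false_imp_iff,
      implies_true, and_true] at hscan
    rw [hnext]
    rintro (q' | γ) p hp hf
    · obtain ⟨rfl, rfl⟩ := hf
      have := hscan.1 _ hp
      simp only [Affine.eval_var, paramEnv] at this
      exact this ⟨rfl, rfl⟩ rfl hc hc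
    · obtain rfl := hf
      by_cases hph : p = hd
      · subst hph
        have := hscan.2 _ hp
        simp only [Affine.eval_var, paramEnv] at this
        exact this ⟨rfl, rfl⟩ rfl hc hc
      · exact hframe p hp hph
  | some r =>
    obtain ⟨q', γ', dir⟩ := r
    have hnext : M.next ⟨q, hd, τ⟩ = ⟨q', moveHead dir hd, Function.update τ hd γ'⟩ := by
      simp [next, step, hδ]
    have hcell : ∀ γ, ∀ p < s, Function.update τ hd γ' p = γ →
        M.VarAt R v s s (M.kind 1 (.cell γ)) p w := by
      intro γ p hp hγ
      by_cases hph : p = hd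
      · subst hph
        rw [Function.update_self] at hγ
        subst hγ
        have := hscan ⟨.head q, .var .p, .cell (τ p), .var .p, .cell γ', .var .p⟩
          (by cases dir <;> simp [scanRules, hδ]) p hp
        simp only [Affine.eval_var, paramEnv] at this
        exact this ⟨rfl, rfl⟩ rfl hc hc
      · rw [Function.update_of_ne hph] at hγ
        exact hγ ▸ hframe p hp hph
    rw [hnext]
    rintro (q'' | γ) p hp hf
    · obtain ⟨rfl, rfl⟩ := hf
      cases dir with
      | right =>
        have := hscan ⟨.head q, .var .p, .cell (τ hd), .var .p, .head q', (Affine.var .p).succ⟩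
          (by simp [scanRules, hδ]) hd hc
        simp only [Affine.eval_var, Affine.eval_succ, paramEnv] at this
        exact this ⟨rfl, rfl⟩ rfl hc hc
      | left =>
        cases hd with
        -- A move to the left from cell `0` leaves the head there and needs the rule with constant
        -- positions.
        | zero =>
          have := hscan ⟨.head q, .ofNat 0, .cell (τ 0), .ofNat 0, .head q', .ofNat 0⟩
            (by simp [scanRules, hδ]) 0 hc
          simp only [Affine.eval_ofNat] at this
          exact this ⟨rfl, rfl⟩ rfl hc hc
        | succ i =>
          have := hscan ⟨.head q, (Affine.var .p).succ, .cell (τ (i + 1)), (Affine.var .p).succ,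
            .head q', .var .p⟩ (by simp [scanRules, hδ]) i (by omega)
          simp only [Affine.eval_var, Affine.eval_succ, paramEnv] at this
          exact this ⟨rfl, rfl⟩ rfl hc hc
    · exact hcell γ p hp hf

/-- Repeated halving of the interval: the first child carries the run from the start to the
midpoint, the second from the midpoint to the end. Only containment of the true facts is maintained;
spurious additional facts are harmless. -/
theorem contains_iterate
    (hS : ∀ t ∈ M.templateSet, ∀ j < s, ∀ p < s, ∀ d < s,
      Sat R v (t.eval (paramEnv j p d n s)) w₀)
    {x : List α} (hx : ∀ t, (M.run x t).head < s) :
    ∀ k ≤ s, ∀ w, IterRel R (s - k) w₀ w → M.LevelAt R v s (s - k) w → ∀ t,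
      M.Contains R v s (s - k) 0 w (M.run x t) →
      M.Contains R v s (s - k) 1 w (M.run x (t + 2 ^ k)) := by
  intro k
  induction k with
  | zero =>
    intro _ w hw hl t h
    rw [pow_zero, run_succ]
    exact contains_next_of_local hS hw hl (hx t) h
  | succ k ih =>
    intro hk w hw hl t h
    obtain ⟨j, hj⟩ : ∃ j, j = s - (k + 1) := ⟨_, rfl⟩
    have hj1 : s - k = j + 1 := by omega
    have hjs : j < s := by omega
    rw [← hj] at hw hl h ⊢
    have ih' := ih (by omega)
    rw [hj1] at ih'
    have htree : ∀ t ∈ M.treeTemplates, Sat R v (t.eval (paramEnv j 0 0 n s)) w₀ :=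
      fun t ht => hS t (Or.inl ht) j hjs 0 (by omega) 0 (by omega)
    have hcopy : ∀ f : M.Fact, ∀ p < s, ∀ t ∈ copyTemplates f,
        Sat R v (t.eval (paramEnv j p 0 n s)) w₀ :=
      fun f p hp t ht => hS t (Or.inr (Or.inl ⟨f, ht⟩)) j hjs p hp 0 (by omega)
    simp only [treeTemplates, List.forall_mem_cons, sat_guardT, Template.eval_dia, sat_dia,
      Template.eval, sat_and, sat_levelT, Template.eval_neg, sat_neg, sat_secondT,
      Affine.eval_succ, Affine.eval_var, paramEnv] at htree
    obtain ⟨-, hfirst, hsecond, -⟩ := htree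
    simp only [copyTemplates, List.forall_mem_cons, sat_guardT, sat_childT, Template.eval,
      sat_imp, Template.eval_neg, sat_neg, sat_secondT, sat_factT,
      Affine.eval_succ, Affine.eval_var, paramEnv] at hcopy
    obtain ⟨u₁, hu₁, hlu₁, hD₁⟩ := hfirst w hw hl
    obtain ⟨u₂, hu₂, hlu₂, hD₂⟩ := hsecond w hw hl
    have hA₁ : M.Contains R v s (j + 1) 0 u₁ (M.run x t) := fun f p hp hf =>
      (hcopy f p hp).1 w hw hl (h f p hp hf) u₁ hu₁ hlu₁ hD₁
    have hB₁ := ih' u₁ (hw.snoc hu₁) hlu₁ t hA₁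
    -- A box transmits information from parent to child only. To bring the child's final
    -- configuration back to the parent, the copying template is contrapositive: a fact absent at
    -- the parent is absent at the child.
    have hM : M.Contains R v s j 2 w (M.run x (t + 2 ^ k)) := fun f p hp hf => by
      by_contra hn
      exact (hcopy f p hp).2.2.1 w hw hl hn u₁ hu₁ hlu₁ hD₁ (hB₁ f p hp hf)
    have hA₂ : M.Contains R v s (j + 1) 0 u₂ (M.run x (t + 2 ^ k)) := fun f p hp hf =>
      (hcopy f p hp).2.1 w hw hl (hM f p hp hf) u₂ hu₂ hlu₂ hD₂
    have hB₂ := ih' u₂ (hw.snoc hu₂) hlu₂ _ hA₂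
    have e : t + 2 ^ k + 2 ^ k = t + 2 ^ (k + 1) := by rw [pow_succ]; omega
    rw [e] at hB₂
    intro f p hp hf
    by_contra hn
    exact (hcopy f p hp).2.2.2.1 w hw hl hn u₂ hu₂ hlu₂ hD₂ (hB₂ f p hp hf)

/-- If the conjuncts can be satisfied in some Kripke model, then the machine does not accept within
`2 ^ s` steps. -/
theorem not_accept_of_sat_conjuncts {x : List α} (hx : ∀ t, (M.run x t).head < s)
    (h : ∀ φ ∈ M.conjuncts x s, Sat R v φ w₀) : (M.run x (2 ^ s)).state ∉ M.accept := by
  have hs : 0 < s := (Nat.zero_le _).trans_lt (hx 0)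
  have hS : ∀ t ∈ M.templateSet, ∀ j < s, ∀ p < s, ∀ d < s,
      Sat R v (t.eval (paramEnv j p d x.length s)) w₀ :=
    fun t ht j hj p hp d hd => h _ (Or.inl ⟨t, ht, j, hj, p, hp, d, hd, rfl⟩)
  have htree : ∀ d < s, ∀ t ∈ M.treeTemplates, Sat R v (t.eval (paramEnv 0 0 d x.length s)) w₀ :=
    fun d hd t ht => hS t (Or.inl ht) 0 hs 0 hs d hd
  simp only [treeTemplates, List.forall_mem_cons, sat_levelT, sat_factT, Affine.eval, paramEnv,
    List.map_cons, List.map_nil, List.sum_cons, List.sum_nil, Nat.add_zero] at htree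
  have hletter : ∀ (k : ℕ) (hk : k < x.length),
      M.VarAt R v s 0 (M.kind 0 (.cell (M.letter x[k]))) k w₀ := by
    intro k hk
    have := h _ (Or.inr ⟨k, hk, rfl⟩)
    simpa only [letterTemplate, sat_factT, Affine.eval_ofNat, Affine.eval_var, paramEnv] using this
  have hA : M.Contains R v s 0 0 w₀ (M.run x 0) := by
    rintro (q | γ) p hp hf
    · obtain ⟨rfl, rfl⟩ := hf
      exact (htree 0 hs).2.2.2.1
    · obtain rfl := hf
      change M.VarAt R v s 0 (M.kind 0 (.cell ((x[p]?).elim M.blank M.letter))) p w₀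
      by_cases hpx : p < x.length
      · rw [List.getElem?_eq_getElem hpx]
        exact hletter p hpx
      · rw [List.getElem?_eq_none (by omega)]
        -- The blank cells are the positions `n + d`, where `n` is the length of the input.
        have := (htree (p - x.length) (by omega)).2.2.2.2.1
        rwa [Nat.add_sub_cancel' (by omega)] at this
  have hB := contains_iterate hS hx s le_rfl w₀ (by rw [Nat.sub_self]; rfl)
    (by rw [Nat.sub_self]; exact (htree 0 hs).1) 0 (by rwa [Nat.sub_self])
  rw [Nat.sub_self, Nat.zero_add] at hB
  intro hacc
  have hlt := hx (2 ^ s)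
  have := hS (M.rejectTemplate (M.run x (2 ^ s)).state) (Or.inr (Or.inr (Or.inl ⟨_, hacc, rfl⟩)))
    0 hs _ hlt 0 hs
  simp only [rejectTemplate, Template.eval_neg, sat_neg, sat_factT, Affine.eval_ofNat,
    Affine.eval_var, paramEnv] at this
  exact this (hB _ _ hlt ⟨rfl, rfl⟩)

end Unsat

/-! ### A model of the conjuncts -/

open TreeWorld

section Model

variable (M) (x : List α) (s : ℕ)

/-- The time at which the configuration number `v` of the `i`-th node at height `j` is reached. -/
def nodeTime (j i : ℕ) : ℕ → ℕ
  | 0 => i * 2 ^ (s - j)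
  | 1 => (i + 1) * 2 ^ (s - j)
  | _ => (2 * i + 1) * 2 ^ (s - (j + 1))

/-- Children of node `i` are `2 * i` and `2 * i + 1`, so parity tells the second child. At `j = s`
the truncated exponent would give midpoints no meaning, but copying stops below level `s`. -/
theorem nodeTime_child {j i : ℕ} (hj : j < s) :
    (¬ i % 2 = 1 → nodeTime s (j + 1) i 0 = nodeTime s j (i / 2) 0 ∧
      nodeTime s (j + 1) i 1 = nodeTime s j (i / 2) 2) ∧
    (i % 2 = 1 → nodeTime s (j + 1) i 0 = nodeTime s j (i / 2) 2 ∧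
      nodeTime s (j + 1) i 1 = nodeTime s j (i / 2) 1) := by
  have hpow : 2 ^ (s - j) = 2 * 2 ^ (s - (j + 1)) := by
    rw [show s - j = s - (j + 1) + 1 by omega, pow_succ, Nat.mul_comm]
  simp only [nodeTime, hpow, ← Nat.mul_assoc]
  refine ⟨fun h => ⟨?_, ?_⟩, fun h => ⟨?_, ?_⟩⟩ <;> congr 1 <;> omega

/-- The gadgets that belong to the `i`-th node at height `j`. -/
def NodeGadget (j i m : ℕ) : Prop :=
  m = atomIdx M.numKinds s (j + 1) 0 0 ∨ (i % 2 = 1 ∧ m = atomIdx M.numKinds s j 1 0) ∨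
    ∃ (v : ℕ) (f : M.Fact) (p : ℕ), v < 3 ∧ m = atomIdx M.numKinds s j (M.kind v f) p ∧
      f.Holds (M.run x (nodeTime s j i v)) p

variable (val : ℕ → TreeWorld → Prop)

theorem varAt_iff {l τ p : ℕ} {w : TreeWorld} :
    M.VarAt (Rel s (M.NodeGadget x s)) val s l τ p w ↔
      ∃ j i, w = node j i ∧ Vis s (M.NodeGadget x s) j i (atomIdx M.numKinds s l τ p) := by
  rw [VarAt, sat_atomF_iff]

/-- The marker with level `l` belongs to the nodes of height `l - 1` and is inherited by all their
ancestors. Two consecutive markers therefore isolate one level. -/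
theorem varAt_level_iff {l : ℕ} (hl : l ≤ s + 1) {w : TreeWorld} :
    M.VarAt (Rel s (M.NodeGadget x s)) val s l 0 0 w ↔ ∃ j i, w = node j i ∧ j < l := by
  rw [varAt_iff]
  constructor
  · rintro ⟨j, i, rfl, j', i', hj, hs, -, h⟩
    refine ⟨j, i, rfl, ?_⟩
    rcases h with h | ⟨-, h⟩ | ⟨v, f, p, hv, h, -⟩
    · have := atomIdx_inj (by omega) (by omega) (by unfold numKinds; omega)
        (by unfold numKinds; omega) h
      omega
    · have := atomIdx_inj (by omega) (by omega) (by unfold numKinds; omega)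
        (by unfold numKinds; omega) h
      omega
    · have := atomIdx_inj (by omega) (by omega) (by unfold numKinds; omega) (kind_lt hv f) h
      unfold kind at this
      omega
  · rintro ⟨j, i, rfl, hj⟩
    -- The leftmost descendant at height `l - 1`.
    refine ⟨j, i, rfl, l - 1, i * 2 ^ (l - 1 - j), by omega, by omega, ?_, Or.inl ?_⟩
    · exact Nat.mul_div_cancel _ (by positivity)
    · rw [Nat.sub_add_cancel (by omega)]

theorem levelAt_iff {l : ℕ} (hl : l ≤ s) {w : TreeWorld} :
    M.LevelAt (Rel s (M.NodeGadget x s)) val s l w ↔ ∃ i, w = node l i := by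
  rw [LevelAt, varAt_level_iff M x s val (by omega), varAt_level_iff M x s val (by omega)]
  constructor
  · rintro ⟨⟨j, i, rfl, hj⟩, h⟩
    refine ⟨i, ?_⟩
    have : ¬ j < l := fun hlt => h ⟨j, i, rfl, hlt⟩
    rw [show j = l by omega]
  · rintro ⟨i, rfl⟩
    refine ⟨⟨l, i, rfl, by omega⟩, ?_⟩
    rintro ⟨j, i', h, hj⟩
    cases h
    omega

theorem vis_self {l i m : ℕ} (hl : l ≤ s) (h : M.NodeGadget x s l i m) :
    Vis s (M.NodeGadget x s) l i m := ⟨l, i, le_rfl, hl, by simp, h⟩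

theorem varAt_second_iff {l i : ℕ} (hl : l ≤ s) :
    M.VarAt (Rel s (M.NodeGadget x s)) val s l 1 0 (node l i) ↔ i % 2 = 1 := by
  rw [varAt_iff]
  constructor
  · rintro ⟨j, i, h, j', i', hj, hs, hi, h'⟩
    cases h
    rcases h' with h | ⟨hodd, h⟩ | ⟨v, f, p, hv, h, -⟩
    · have := atomIdx_inj (by omega) (by omega) (by unfold numKinds; omega)
        (by unfold numKinds; omega) h
      omega
    · have := atomIdx_inj (by omega) (by omega) (by unfold numKinds; omega)
        (by unfold numKinds; omega) h
      obtain rfl : l = j' := this.1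
      simp only [Nat.sub_self, pow_zero, Nat.div_one] at hi
      exact hi ▸ hodd
    · have := atomIdx_inj (by omega) (by omega) (by unfold numKinds; omega) (kind_lt hv f) h
      unfold kind at this
      omega
  · exact fun h => ⟨l, i, rfl, vis_self M x s hl (Or.inr (Or.inl ⟨h, rfl⟩))⟩

/-- By injectivity of the numbering, a gadget with level digit `l` and this kind belongs to a node
of height `l`, and the only descendant of `node l i` at that height is itself. Inheritance thus adds
nothing at the level where the variable is used. -/
theorem varAt_fact_iff {l i : ℕ} (hl : l ≤ s) {v : ℕ} (hv : v < 3) (f : M.Fact) (p : ℕ) :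
    M.VarAt (Rel s (M.NodeGadget x s)) val s l (M.kind v f) p (node l i) ↔
      f.Holds (M.run x (nodeTime s l i v)) p := by
  rw [varAt_iff]
  constructor
  · rintro ⟨j, i, h, j', i', hj, hs, hi, h'⟩
    cases h
    rcases h' with h | ⟨-, h⟩ | ⟨v', f', p', hv', h, hf⟩
    · have := atomIdx_inj (by omega) (by omega) (kind_lt hv f) (by unfold numKinds; omega) h
      unfold kind at this
      omega
    · have := atomIdx_inj (by omega) (by omega) (kind_lt hv f) (by unfold numKinds; omega) h
      unfold kind at this
      omega
    · obtain ⟨rfl, hk, rfl⟩ := atomIdx_inj (by omega) (by omega) (kind_lt hv f) (kind_lt hv' f') h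
      obtain ⟨rfl, rfl⟩ := kind_inj hv hv' hk
      simp only [Nat.sub_self, pow_zero, Nat.div_one] at hi
      exact hi ▸ hf
  · exact fun h => ⟨l, i, rfl,
      vis_self M x s hl (Or.inr (Or.inr ⟨v, f, p, hv, rfl, h⟩))⟩

/-- The rules are true of actual configurations at all positions, including those beyond the space
bound that arise when parameters are added. -/
theorem localRule_sound {q : M.Q} {γ : M.Γ} {ρ : M.LocalRule}
    (hρ : ρ ∈ scanRules q γ ++ frameRules q γ) (e : LoopVar → ℕ) (c : M.Cfg)
    (h1 : ρ.fact₁.Holds c (ρ.pos₁.eval e)) (h2 : ρ.fact₂.Holds c (ρ.pos₂.eval e)) :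
    ρ.fact₃.Holds (M.next c) (ρ.pos₃.eval e) := by
  obtain ⟨q₀, h₀, τ⟩ := c
  rcases List.mem_append.1 hρ with hρ | hρ
  · cases hδ : M.δ q γ with
    | none =>
      simp only [scanRules, hδ, List.mem_cons, List.not_mem_nil, or_false] at hρ
      rcases hρ with rfl | rfl <;>
        obtain ⟨h1q, h1p⟩ := h1 <;> dsimp only at h1q h1p h2 <;> subst h1q h1p <;>
        simp only [Fact.Holds, Affine.eval_var] at h2 <;>
        simp [next, step, Fact.Holds, h2, hδ]
    | some r =>
      obtain ⟨q', γ', dir⟩ := r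
      cases dir <;> simp only [scanRules, hδ, List.mem_cons, List.not_mem_nil, or_false] at hρ
      · rcases hρ with rfl | rfl | rfl <;>
          obtain ⟨h1q, h1p⟩ := h1 <;> dsimp only at h1q h1p h2 <;> subst h1q h1p <;>
          simp only [Fact.Holds, Affine.eval_var, Affine.eval_succ, Affine.eval_ofNat] at h2 <;>
          simp [next, step, Fact.Holds, h2, hδ, moveHead]
      · rcases hρ with rfl | rfl <;>
          obtain ⟨h1q, h1p⟩ := h1 <;> dsimp only at h1q h1p h2 <;> subst h1q h1p <;>
          simp only [Fact.Holds, Affine.eval_var] at h2 <;>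
          simp [next, step, Fact.Holds, h2, hδ, moveHead]
  · have key : ∀ p, p ≠ h₀ → τ p = γ → (M.next ⟨q₀, h₀, τ⟩).tape p = γ := by
      intro p hp hγ
      simp only [next, step]
      cases M.δ q₀ (τ h₀) with
      | none => exact hγ
      | some r => exact (Function.update_of_ne hp _ _).trans hγ
    simp only [frameRules, List.mem_cons, List.not_mem_nil, or_false] at hρ
    rcases hρ with rfl | rfl <;>
      obtain ⟨h1q, h1p⟩ := h1 <;> dsimp only at h1q h1p h2 <;> subst h1q h1p <;>
      exact key _ (by simp [Affine.eval, Affine.var]; try omega) h2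

theorem sat_template {t : Template} (ht : t ∈ M.templateSet)
    (hrej : (M.run x (2 ^ s)).state ∉ M.accept) {j p d : ℕ} (hj : j < s) :
    Sat (Rel s (M.NodeGadget x s)) val (t.eval (paramEnv j p d x.length s)) (node 0 0) := by
  have hguard : ∀ {e : LoopVar → ℕ} {r : LoopVar} {φ : Template}, e .s = s → e r ≤ s →
      (∀ i, Sat (Rel s (M.NodeGadget x s)) val (φ.eval e) (node (e r) i)) →
      Sat (Rel s (M.NodeGadget x s)) val ((M.guardT r φ).eval e) (node 0 0) := by
    intro e r φ hs hr h
    rw [sat_guardT, hs]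
    intro u _ hu
    obtain ⟨i, rfl⟩ := (levelAt_iff M x s val hr).1 hu
    exact h i
  have hchild : ∀ {i : ℕ} {u : TreeWorld}, Rel s (M.NodeGadget x s) (node j i) u →
      M.LevelAt (Rel s (M.NodeGadget x s)) val s (j + 1) u →
      ∃ i', u = node (j + 1) i' ∧ i' / 2 = i := by
    intro i u hu hl
    obtain ⟨i', rfl⟩ := (levelAt_iff M x s val (by omega)).1 hl
    refine ⟨i', rfl, ?_⟩
    have := hu.2.2
    simpa [Nat.add_sub_cancel_left] using this
  have hrel : ∀ i b, b < 2 → Rel s (M.NodeGadget x s) (node j i) (node (j + 1) (2 * i + b)) := by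
    intro i b hb
    refine ⟨by omega, by omega, ?_⟩
    rw [Nat.add_sub_cancel_left, pow_one]
    omega
  rcases ht with ht | ⟨f, ht⟩ | ⟨q, hq, rfl⟩ | ⟨q, γ, ρ, hρ, rfl⟩
  · simp only [treeTemplates, List.mem_cons, List.not_mem_nil, or_false] at ht
    rcases ht with rfl | rfl | rfl | rfl | rfl
    · rw [sat_levelT]
      exact (levelAt_iff M x s val (by simp)).2 ⟨0, by simp⟩
    · refine hguard rfl hj.le fun i => ?_
      simp only [Template.eval_dia, sat_dia, Template.eval, sat_and, sat_levelT,
        Template.eval_neg, sat_neg, sat_secondT, Affine.eval_succ, Affine.eval_var, paramEnv]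
      refine ⟨_, hrel i 0 (by omega), (levelAt_iff M x s val (by omega)).2 ⟨_, rfl⟩, ?_⟩
      rw [varAt_second_iff M x s val (by omega)]
      omega
    · refine hguard rfl hj.le fun i => ?_
      simp only [Template.eval_dia, sat_dia, Template.eval, sat_and, sat_levelT,
        sat_secondT, Affine.eval_succ, Affine.eval_var, paramEnv]
      refine ⟨_, hrel i 1 (by omega), (levelAt_iff M x s val (by omega)).2 ⟨_, rfl⟩, ?_⟩
      rw [varAt_second_iff M x s val (by omega)]
      omega
    · rw [sat_factT, Affine.eval_ofNat]
      refine (varAt_fact_iff M x s val (by omega) (by omega) _ _).2 ?_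
      simp [nodeTime, Fact.Holds, run, init]
    · rw [sat_factT, Affine.eval_ofNat]
      refine (varAt_fact_iff M x s val (by omega) (by omega) _ _).2 ?_
      simp [nodeTime, Fact.Holds, run, init, Affine.eval, paramEnv]
  · simp only [copyTemplates, List.mem_cons, List.not_mem_nil, or_false] at ht
    rcases ht with rfl | rfl | rfl | rfl <;>
      (refine hguard rfl hj.le fun i => ?_
       simp only [Template.eval, sat_imp, sat_childT, sat_factT, Template.eval_neg, sat_neg,
        sat_secondT, Affine.eval_succ, Affine.eval_var, paramEnv]
       rw [varAt_fact_iff M x s val (by omega) (by omega)]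
       intro hf u hu hl
       obtain ⟨i', rfl, rfl⟩ := hchild hu hl
       rw [varAt_second_iff M x s val (by omega), varAt_fact_iff M x s val (by omega) (by omega)]
       intro hi
       -- Copying is an equality of times: the configurations of parent and child to be compared are
       -- the same moment of the run, so both directions of copying hold.
       have H := nodeTime_child s (i := i') hj
       first
        | rwa [(H.1 hi).1] | rwa [(H.1 hi).2] | rwa [(H.2 hi).1] | rwa [(H.2 hi).2])
  · simp only [rejectTemplate, Template.eval_neg, sat_neg, sat_factT, Affine.eval_ofNat]
    have := (varAt_fact_iff M x s val (l := 0) (i := 0) (by omega) (v := 1) (by omega)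
      (.head q) ((Affine.var .p).eval (paramEnv j p d x.length s))).1
    intro h
    have hq' := (this h).1
    simp only [nodeTime, Nat.zero_add, Nat.one_mul, Nat.sub_zero] at hq'
    exact hrej (hq' ▸ hq)
  · refine hguard rfl le_rfl fun i => ?_
    simp only [Template.eval, sat_imp, sat_factT, Affine.eval_var, paramEnv]
    rw [varAt_fact_iff M x s val le_rfl (by omega), varAt_fact_iff M x s val le_rfl (by omega),
      varAt_fact_iff M x s val le_rfl (by omega)]
    simp only [nodeTime, Nat.sub_self, pow_zero, Nat.mul_one]
    rw [run_succ]
    exact localRule_sound M hρ _ _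

/-- If the machine does not accept, then all the conjuncts hold at the root of the tree model. -/
theorem sat_conjuncts (hrej : (M.run x (2 ^ s)).state ∉ M.accept) {φ : ModalFormula}
    (hφ : φ ∈ M.conjuncts x s) : Sat (Rel s (M.NodeGadget x s)) val φ (node 0 0) := by
  rcases hφ with ⟨t, ht, j, hj, p, -, d, -, rfl⟩ | ⟨k, hk, rfl⟩
  · exact sat_template M x s val ht hrej hj
  · rw [letterTemplate, sat_factT, Affine.eval_ofNat]
    refine (varAt_fact_iff M x s val (by omega) (by omega) _ _).2 ?_
    simp [nodeTime, Fact.Holds, run, init, paramEnv, hk]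

end Model

end SpaceMachine

/-! ### Programs on stacks -/

open Turing

/-- Programs that operate on stacks: `loop k body` pops the stack `k` until it is empty and runs
`body a` for every popped symbol `a`. -/
inductive StackProg {K : Type} (Γ : K → Type) : Type
  | skip
  | push (k : K) (a : Γ k)
  | seq (P P' : StackProg Γ)
  | loop (k : K) (body : Γ k → StackProg Γ)

namespace StackProg

variable {K : Type} {Γ : K → Type}

/-- The labels of the compiled program. -/
def Lab : StackProg Γ → Type
  | skip => Unit
  | push _ _ => Unit
  | seq P P' => P.Lab ⊕ P'.Lab
  | loop _ body => Option (Σ a, (body a).Lab)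

theorem finite_lab [∀ k, Finite (Γ k)] (P : StackProg Γ) : Finite P.Lab := by
  induction P with
  | skip => exact inferInstanceAs (Finite Unit)
  | push k a => exact inferInstanceAs (Finite Unit)
  | seq P P' h h' => exact inferInstanceAs (Finite (P.Lab ⊕ P'.Lab))
  | loop k body h => exact inferInstanceAs (Finite (Option (Σ a, (body a).Lab)))

/-- The first label of the compiled program. -/
def entry : (P : StackProg Γ) → P.Lab
  | skip => ()
  | push _ _ => ()
  | seq P _ => Sum.inl P.entry
  | loop _ _ => none

/-- The memory of the compiled program: the symbol popped last, if any. -/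
abbrev Mem (Γ : K → Type) : Type := Option (Σ k, Γ k)

variable [DecidableEq K]

/-- The label at which a loop continues after a pop. -/
def loopTarget {Λ : Type} (k : K) (start : Γ k → Λ) (exit : Λ) : Mem Γ → Λ
  | none => exit
  -- The pop in the loop code tags its symbol with `k`, so after it the last branch is never taken.
  | some ⟨k', a⟩ => if h : k' = k then start (h ▸ a) else exit

/-- The statements of the compiled program, where `emb` embeds its labels into those of a larger
machine and `exit` is the label to go to at the end. -/
def code {Λ : Type} : (P : StackProg Γ) → (P.Lab → Λ) → Λ → P.Lab → TM2.Stmt Γ Λ (Mem Γ)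
  | skip, _, exit, _ => .goto fun _ => exit
  | push k a, _, exit, _ => .push k (fun _ => a) (.goto fun _ => exit)
  | seq P P', emb, exit, l =>
    match l with
    | Sum.inl l => P.code (emb ∘ Sum.inl) (emb (Sum.inr P'.entry)) l
    | Sum.inr l => P'.code (emb ∘ Sum.inr) exit l
  | loop k body, emb, exit, l =>
    match l with
    | none => .pop k (fun _ o => o.map (Sigma.mk k))
        (.goto (loopTarget k (fun a => emb (some ⟨a, (body a).entry⟩)) exit))
    | some ⟨a, l⟩ => (body a).code (fun l => emb (some ⟨a, l⟩)) (emb none) l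

/-- `P.Run S S' t`: the program `P` started with the stacks `S` stops after `t` steps with the
stacks `S'`. -/
inductive Run : StackProg Γ → (∀ k, List (Γ k)) → (∀ k, List (Γ k)) → ℕ → Prop
  | skip (S) : Run skip S S 1
  | push (S) (k : K) (a : Γ k) : Run (push k a) S (Function.update S k (a :: S k)) 1
  | seq {P P' S S' S'' t t'} : Run P S S' t → Run P' S' S'' t' → Run (seq P P') S S'' (t + t')
  | loop_nil {k : K} {body S} : S k = [] → Run (loop k body) S S 1
  | loop_cons {k : K} {body : Γ k → StackProg Γ} {S S' S'' t t' a l} : S k = a :: l →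
      Run (body a) (Function.update S k l) S' t → Run (loop k body) S' S'' t' →
      Run (loop k body) S S'' (1 + t + t')

/-- The configuration `c` leads to `c'` in exactly `t` steps. -/
def StepsTo {C : Type} (f : C → Option C) (t : ℕ) (c c' : C) : Prop :=
  (flip bind f)^[t] (some c) = some c'

theorem StepsTo.trans {C : Type} {f : C → Option C} {t t' : ℕ} {c c' c'' : C}
    (h : StepsTo f t c c') (h' : StepsTo f t' c' c'') : StepsTo f (t + t') c c'' := by
  unfold StepsTo at *
  rw [Nat.add_comm, Function.iterate_add_apply, h, h']

theorem StepsTo.single {C : Type} {f : C → Option C} {c c' : C} (h : f c = some c') :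
    StepsTo f 1 c c' := h

/-- Correctness of the compilation. -/
theorem Run.stepsTo {P : StackProg Γ} {S S' : ∀ k, List (Γ k)} {t : ℕ} (h : P.Run S S' t)
    {Λ : Type} (m : Λ → TM2.Stmt Γ Λ (Mem Γ)) (emb : P.Lab → Λ) (exit : Λ)
    (hm : ∀ l, m (emb l) = P.code emb exit l) (v : Mem Γ) :
    ∃ v', StepsTo (TM2.step m) t ⟨some (emb P.entry), v, S⟩ ⟨some exit, v', S'⟩ := by
  induction h generalizing exit v with
  | skip S =>
    refine ⟨v, .single ?_⟩
    simp only [TM2.step, hm, code, TM2.stepAux]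
  | push S k a =>
    refine ⟨v, .single ?_⟩
    simp only [TM2.step, hm, code, TM2.stepAux]
  | @seq P P' S S' S'' t t' _ _ ih ih' =>
    obtain ⟨v₁, h₁⟩ := ih (emb ∘ Sum.inl) (emb (Sum.inr P'.entry)) (fun l => hm (Sum.inl l)) v
    obtain ⟨v₂, h₂⟩ := ih' (emb ∘ Sum.inr) exit (fun l => hm (Sum.inr l)) v₁
    exact ⟨v₂, h₁.trans h₂⟩
  | @loop_nil k body S hS =>
    refine ⟨none, .single ?_⟩
    have := hm none
    simp only [entry, TM2.step, this, code, TM2.stepAux, hS, List.head?_nil, Option.map_none,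
      loopTarget, List.tail_nil]
    rw [← hS, Function.update_eq_self]
  | @loop_cons k body S S' S'' t t' a l hS _ _ ih ih' =>
    obtain ⟨v₁, h₁⟩ := ih (fun l => emb (some ⟨a, l⟩)) (emb none)
      (fun l => hm (some ⟨a, l⟩)) (some ⟨k, a⟩)
    obtain ⟨v₂, h₂⟩ := ih' emb exit hm v₁
    refine ⟨v₂, (StepsTo.trans (.single ?_) h₁).trans h₂⟩
    have := hm none
    simp [entry, TM2.step, this, code, TM2.stepAux, hS, loopTarget]

/-- The machine that runs the program `P`. -/
noncomputable def toFinTM2 [Fintype K] [∀ k, Finite (Γ k)] (k₀ k₁ : K) (P : StackProg Γ) :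
    FinTM2 :=
  have := P.finite_lab
  { K := K
    k₀ := k₀
    k₁ := k₁
    Γ := Γ
    Λ := Option P.Lab
    main := some P.entry
    ΛFin := Fintype.ofFinite _
    σ := Mem Γ
    initialState := none
    σFin := Fintype.ofFinite _
    Γk₀Fin := Fintype.ofFinite _
    m := fun
      | none => .load (fun _ => none) .halt
      | some l => P.code some none l }

/-- The stacks that are all empty but for the stack `k`. -/
def single (k : K) (x : List (Γ k)) : ∀ k, List (Γ k) := Function.update (fun _ => []) k x

theorem single_self (k : K) (x : List (Γ k)) : single k x k = x := Function.update_self _ _ _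

theorem single_of_ne {k k' : K} (h : k' ≠ k) (x : List (Γ k)) : single k x k' = [] :=
  Function.update_of_ne h _ _

/-- A function that is computed by a stack program in polynomial time is computable in
polynomial time. -/
theorem nonempty_computableInPolyTime [Fintype K] [∀ k, Finite (Γ k)] (k₀ k₁ : K)
    (P : StackProg Γ) (f : List (Γ k₀) → List (Γ k₁)) (q : Polynomial ℕ)
    (hP : ∀ x, ∃ t ≤ q.eval x.length, P.Run (single k₀ x) (single k₁ (f x)) t) :
    Nonempty (TM2ComputableInPolyTime (id : List (Γ k₀) → _) (id : List (Γ k₁) → _) f) := by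
  refine ⟨{
    tm := P.toFinTM2 k₀ k₁
    inputAlphabet := Equiv.refl _
    outputAlphabet := Equiv.refl _
    time := q + 1
    outputsFun := fun x => ?_ }⟩
  apply Classical.choice
  obtain ⟨t, ht, hrun⟩ := hP x
  obtain ⟨v, hv⟩ := hrun.stepsTo (P.toFinTM2 k₀ k₁).m some none (fun l => rfl) none
  -- The additional label resets the memory, because the prescribed halting configuration has the
  -- initial internal state. It accounts for the `1` added to the time.
  have hlast : StepsTo (TM2.step (P.toFinTM2 k₀ k₁).m) 1 ⟨some none, v, single k₁ (f x)⟩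
      ⟨none, none, single k₁ (f x)⟩ := rfl
  have h := hv.trans hlast
  have hin : initList (P.toFinTM2 k₀ k₁) (List.map (Equiv.refl (Γ k₀)).invFun x) =
      ⟨some (some P.entry), none, single k₀ x⟩ := by
    refine (congrArg (initList (P.toFinTM2 k₀ k₁)) (List.map_id x)).trans ?_
    unfold initList
    congr 1
    refine funext fun k : K => ?_
    by_cases hk : k₀ = k
    · subst hk
      exact (dif_pos rfl).trans (single_self _ _).symm
    · exact (dif_neg (Ne.symm hk)).trans (single_of_ne (Ne.symm hk) _).symm
  have hout : haltList (P.toFinTM2 k₀ k₁) (List.map (Equiv.refl (Γ k₁)).invFun (f x)) =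
      ⟨none, none, single k₁ (f x)⟩ := by
    refine (congrArg (haltList (P.toFinTM2 k₀ k₁)) (List.map_id (f x))).trans ?_
    unfold haltList
    congr 1
    refine funext fun k : K => ?_
    by_cases hk : k₁ = k
    · subst hk
      exact (dif_pos rfl).trans (single_self _ _).symm
    · exact (dif_neg (Ne.symm hk)).trans (single_of_ne (Ne.symm hk) _).symm
  refine ⟨⟨⟨t + 1, ?_⟩, ?_⟩⟩
  · change (flip bind _)^[t + 1] (some (initList (P.toFinTM2 k₀ k₁)
      (List.map (Equiv.refl (Γ k₀)).invFun x))) = some (haltList (P.toFinTM2 k₀ k₁)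
      (List.map (Equiv.refl (Γ k₁)).invFun (f x)))
    rw [hin, hout]
    exact h
  · simpa using ht

/-- The time of a loop all of whose passes take bounded time: `S i` are the stacks when `i` passes
remain. -/
theorem Run.loop_of_forall {k : K} {body : Γ k → StackProg Γ} {b : ℕ} (n : ℕ)
    (S : ℕ → ∀ k, List (Γ k)) (h0 : S 0 k = [])
    (h : ∀ i < n, ∃ a l, S (i + 1) k = a :: l ∧
      ∃ t ≤ b, (body a).Run (Function.update (S (i + 1)) k l) (S i) t) :
    ∃ t ≤ n * (b + 1) + 1, (loop k body).Run (S n) (S 0) t := by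
  induction n with
  | zero => exact ⟨1, by omega, .loop_nil h0⟩
  | succ n ih =>
    obtain ⟨a, l, hS, t, ht, hrun⟩ := h n (by omega)
    obtain ⟨t', ht', hrun'⟩ := ih fun i hi => h i (by omega)
    refine ⟨1 + t + t', ?_, .loop_cons hS hrun hrun'⟩
    rw [Nat.succ_mul]
    omega

end StackProg

/-! ### Writing formulas -/

/-- The counters: the parameters of the templates, the stride `s + 2`, the complements of the
three loop indices, two auxiliary loop counters, and three counters for computing powers. -/
inductive Reg : Type
  | var (v : LoopVar)
  | stride
  | rj
  | rp
  | rd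
  | t₁
  | t₂
  | base
  | cur
  | new
  deriving DecidableEq, Fintype

/-- The stacks: the input, a second stack for input letters, the output, and the counters. -/
inductive Stk : Type
  | inp
  | aux
  | out
  | ctr (r : Reg)
  deriving DecidableEq, Fintype

/-- The stack alphabets. -/
abbrev StkAlph (α : Type) : Stk → Type
  | .inp => α
  | .aux => α
  | .out => Symbol
  | .ctr _ => Unit

instance (α : Type) [Finite α] (k : Stk) : Finite (StkAlph α k) := by
  cases k
  · exact ‹Finite α›
  · exact ‹Finite α›
  · exact inferInstanceAs (Finite Symbol)
  · exact inferInstanceAs (Finite Unit)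

namespace StackProg

variable {α : Type}

/-- The programs used here. -/
abbrev WordProg (α : Type) : Type := StackProg (StkAlph α)

/-- The stacks with given contents. -/
def stk (i a : List α) (o : List Symbol) (e : Reg → ℕ) : ∀ k, List (StkAlph α k)
  | .inp => i
  | .aux => a
  | .out => o
  | .ctr r => List.replicate (e r) ()

variable {i a : List α} {o : List Symbol} {e : Reg → ℕ}

theorem update_inp (i' : List α) :
    Function.update (stk i a o e) Stk.inp i' = stk i' a o e := by
  funext k
  cases k <;> simp [Function.update, stk]

theorem update_aux (a' : List α) :
    Function.update (stk i a o e) Stk.aux a' = stk i a' o e := by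
  funext k
  cases k <;> simp [Function.update, stk]

theorem update_out (o' : List Symbol) :
    Function.update (stk i a o e) Stk.out o' = stk i a o' e := by
  funext k
  cases k <;> simp [Function.update, stk]

theorem update_ctr (r : Reg) (n : ℕ) :
    Function.update (stk i a o e) (Stk.ctr r) (List.replicate n ()) =
      stk i a o (Function.update e r n) := by
  funext k
  rcases k with _ | _ | _ | r'
  · rfl
  · rfl
  · rfl
  · by_cases h : r' = r
    · subst h; simp [stk]
    · simp [stk, h]

/-- The program stops within `t` steps, with the given final stacks. -/
def Runs (P : WordProg α) (S S' : ∀ k, List (StkAlph α k)) (t : ℕ) : Prop :=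
  ∃ t' ≤ t, P.Run S S' t'

theorem Runs.mono {P : WordProg α} {S S'} {t t' : ℕ} (h : P.Runs S S' t) (ht : t ≤ t') :
    P.Runs S S' t' :=
  let ⟨u, hu, hr⟩ := h
  ⟨u, hu.trans ht, hr⟩

theorem Runs.seq {P P' : WordProg α} {S S' S''} {t t' : ℕ} (h : P.Runs S S' t)
    (h' : P'.Runs S' S'' t') : (seq P P').Runs S S'' (t + t') :=
  let ⟨_, hu, hr⟩ := h
  let ⟨_, hu', hr'⟩ := h'
  ⟨_, Nat.add_le_add hu hu', .seq hr hr'⟩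

/-- Writing one symbol. -/
def emit (c : Symbol) : WordProg α := push Stk.out c

/-- Incrementing a counter. -/
def incr (r : Reg) : WordProg α := push (Stk.ctr r) ()

theorem runs_skip (S : ∀ k, List (StkAlph α k)) : (skip : WordProg α).Runs S S 1 :=
  ⟨1, le_rfl, .skip S⟩

theorem runs_emit (c : Symbol) : (emit c).Runs (stk i a o e) (stk i a (c :: o) e) 1 := by
  have h : (push Stk.out c : WordProg α).Run (stk i a o e)
      (Function.update (stk i a o e) Stk.out (c :: o)) 1 :=
    Run.push (Γ := StkAlph α) (stk i a o e) Stk.out c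
  rw [update_out] at h
  exact ⟨1, le_rfl, h⟩

theorem runs_push_aux (c : α) : (push Stk.aux c : WordProg α).Runs (stk i a o e)
    (stk i (c :: a) o e) 1 := by
  have h : (push Stk.aux c : WordProg α).Run (stk i a o e)
      (Function.update (stk i a o e) Stk.aux (c :: a)) 1 :=
    Run.push (Γ := StkAlph α) (stk i a o e) Stk.aux c
  rw [update_aux] at h
  exact ⟨1, le_rfl, h⟩

theorem runs_push_inp (c : α) : (push Stk.inp c : WordProg α).Runs (stk i a o e)
    (stk (c :: i) a o e) 1 := by
  have h : (push Stk.inp c : WordProg α).Run (stk i a o e)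
      (Function.update (stk i a o e) Stk.inp (c :: i)) 1 :=
    Run.push (Γ := StkAlph α) (stk i a o e) Stk.inp c
  rw [update_inp] at h
  exact ⟨1, le_rfl, h⟩

theorem runs_incr (r : Reg) : (incr r).Runs (stk i a o e)
    (stk i a o (Function.update e r (e r + 1))) 1 := by
  have h : (push (Stk.ctr r) () : WordProg α).Run (stk i a o e)
      (Function.update (stk i a o e) (Stk.ctr r) (List.replicate (e r + 1) ())) 1 :=
    Run.push (Γ := StkAlph α) (stk i a o e) (Stk.ctr r) ()
  rw [update_ctr] at h
  exact ⟨1, le_rfl, h⟩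

/-- A loop over a counter. -/
theorem runs_loop_ctr {r : Reg} {P : WordProg α} {b : ℕ} (n : ℕ)
    (I A : ℕ → List α) (O : ℕ → List Symbol) (E : ℕ → Reg → ℕ) (hE : ∀ k ≤ n, E k r = n - k)
    (h : ∀ k < n, P.Runs (stk (I k) (A k) (O k) (Function.update (E k) r (n - k - 1)))
      (stk (I (k + 1)) (A (k + 1)) (O (k + 1)) (E (k + 1))) b) :
    (loop (Stk.ctr r) fun _ => P).Runs (stk (I 0) (A 0) (O 0) (E 0))
      (stk (I n) (A n) (O n) (E n)) (n * (b + 1) + 1) := by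
  have := Run.loop_of_forall (Γ := StkAlph α) (k := Stk.ctr r) (body := fun _ => P) (b := b) n
    (fun j => stk (I (n - j)) (A (n - j)) (O (n - j)) (E (n - j)))
    (by simp [stk, hE]) (fun j hj => by
      refine ⟨(), List.replicate j (), ?_, ?_⟩
      · change List.replicate (E (n - (j + 1)) r) () = _
        rw [hE _ (by omega), show n - (n - (j + 1)) = j + 1 by omega]
        rfl
      · have h' := h (n - (j + 1)) (by omega)
        rw [show n - (n - (j + 1)) - 1 = j by omega, show n - (j + 1) + 1 = n - j by omega] at h'
        rw [update_ctr]
        exact h')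
  simp only [Nat.sub_self, Nat.sub_zero] at this
  exact this

/-- The words `w 0, …, w (n - 1)`, concatenated from right to left. -/
def cat {β : Type} (w : ℕ → List β) : ℕ → List β
  | 0 => []
  | n + 1 => w n ++ cat w n

theorem mem_cat {β : Type} {w : ℕ → List β} {n : ℕ} {b : β} :
    b ∈ cat w n ↔ ∃ k < n, b ∈ w k := by
  induction n with
  | zero => simp [cat]
  | succ n ih =>
    rw [cat, List.mem_append, ih]
    constructor
    · rintro (h | ⟨k, hk, h⟩)
      · exact ⟨n, by omega, h⟩
      · exact ⟨k, by omega, h⟩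
    · rintro ⟨k, hk, h⟩
      rcases Nat.lt_succ_iff_lt_or_eq.1 hk with hk | rfl
      · exact Or.inr ⟨k, hk, h⟩
      · exact Or.inl h

theorem cat_replicate {β : Type} (c n : ℕ) (b : β) :
    cat (fun _ => List.replicate c b) n = List.replicate (c * n) b := by
  induction n with
  | zero => rfl
  | succ n ih => rw [cat, ih, List.replicate_append_replicate, Nat.mul_succ, Nat.add_comm]

/-- The counter `r` is decremented and the counter `t` is incremented until `r` vanishes; then `r`
is restored. -/
def forLoop (r t : Reg) (P : WordProg α) : WordProg α :=
  seq (loop (Stk.ctr r) fun _ => seq P (incr t)) (loop (Stk.ctr t) fun _ => incr r)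

/-- The values of the counters during the `k`-th pass of a loop. -/
def passEnv (e : Reg → ℕ) (r t : Reg) (k : ℕ) : Reg → ℕ :=
  Function.update (Function.update e r (e r - k - 1)) t k

theorem runs_forLoop {r t : Reg} (hrt : r ≠ t) {P : WordProg α} {b : ℕ} (O : ℕ → List Symbol)
    (E : ℕ → Reg → ℕ) (n : ℕ) (hr : ∀ k, E k r = n) (ht : ∀ k, E k t = 0)
    (h : ∀ k < n, P.Runs (stk i a (O k) (passEnv (E k) r t k))
      (stk i a (O (k + 1)) (passEnv (E (k + 1)) r t k)) b) :
    (forLoop r t P).Runs (stk i a (O 0) (E 0)) (stk i a (O n) (E n))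
      (n * (b + 2) + n * 2 + 2) := by
  have h1 := runs_loop_ctr (α := α) (r := r) (P := seq P (incr t)) (b := b + 1) n
    (fun _ => i) (fun _ => a) O
    (fun k => Function.update (Function.update (E k) r (n - k)) t k)
    (fun k _ => by simp [hrt]) (fun k hk => by
      have h' := (h k hk).seq (runs_incr t)
      convert h' using 2
      · funext x
        simp only [passEnv, Function.update_apply, hr]
        split_ifs <;> simp_all
      · funext x
        simp only [passEnv, Function.update_apply, hr]
        split_ifs <;> simp_all
        omega)
  have h2 := runs_loop_ctr (α := α) (r := t) (P := incr r) (b := 1) n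
    (fun _ => i) (fun _ => a) (fun _ => O n)
    (fun k => Function.update (Function.update (E n) r k) t (n - k))
    (fun k _ => by simp) (fun k hk => by
      convert runs_incr r using 2
      funext x
      simp only [Function.update_apply]
      split_ifs <;> simp_all
      omega)
  have e0 : Function.update (Function.update (E 0) r (n - 0)) t 0 = E 0 := by
    funext x
    simp only [Function.update_apply]
    split_ifs <;> simp_all
  have e1 : Function.update (Function.update (E n) r n) t (n - n) = E n := by
    funext x
    simp only [Function.update_apply]
    split_ifs <;> simp_all
  rw [e0, Nat.sub_self] at h1
  rw [e1, Nat.sub_zero] at h2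
  exact (h1.seq h2).mono (by ring_nf; omega)

/-- The program writes the word `w` in at most `t` steps, and does not change anything else. -/
def Emits (P : WordProg α) (e : Reg → ℕ) (w : List Symbol) (t : ℕ) : Prop :=
  ∀ i a o, P.Runs (stk i a o e) (stk i a (w ++ o) e) t

theorem Emits.seq {P P' : WordProg α} {w w' : List Symbol} {t t' : ℕ} (h : P.Emits e w t)
    (h' : P'.Emits e w' t') : (seq P P').Emits e (w' ++ w) (t + t') := fun i a o => by
  rw [List.append_assoc]
  exact (h i a o).seq (h' i a _)

theorem emits_emit (c : Symbol) : (emit c : WordProg α).Emits e [c] 1 := fun _ _ _ => runs_emit c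

theorem emits_skip : (skip : WordProg α).Emits e [] 1 := fun _ _ _ => runs_skip _

theorem Emits.forLoop {r t : Reg} (hrt : r ≠ t) {P : WordProg α} {b : ℕ} {w : ℕ → List Symbol}
    (ht : e t = 0) (h : ∀ k < e r, P.Emits (passEnv e r t k) (w k) b) :
    (forLoop r t P).Emits e (cat w (e r)) (e r * (b + 2) + e r * 2 + 2) := fun i a o => by
  refine runs_forLoop hrt (fun k => cat w k ++ o) (fun _ => e) (e r) (fun _ => rfl)
    (fun _ => ht) fun k hk => ?_
  rw [cat, List.append_assoc]
  exact h k hk i a (cat w k ++ o)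

/-- If the counters are bounded by `B` and satisfy `C`, then the program writes the word `w`, in
time polynomial in `B`. -/
def PolyEmits (C : (Reg → ℕ) → Prop) (P : WordProg α) (w : (Reg → ℕ) → List Symbol) : Prop :=
  ∃ q : Polynomial ℕ, ∀ B e, (∀ r, e r ≤ B) → C e → P.Emits e (w e) (q.eval B)

variable {C C' : (Reg → ℕ) → Prop} {w w' : (Reg → ℕ) → List Symbol} {P P' : WordProg α}

theorem polyEmits_skip : PolyEmits C (skip : WordProg α) fun _ => [] :=
  ⟨1, fun _ _ _ _ => by simpa using emits_skip⟩

theorem polyEmits_emit (c : Symbol) : PolyEmits C (emit c : WordProg α) fun _ => [c] :=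
  ⟨1, fun _ _ _ _ => by simpa using emits_emit c⟩

theorem PolyEmits.seq (h : PolyEmits C P w) (h' : PolyEmits C P' w') :
    PolyEmits C (seq P P') fun e => w' e ++ w e := by
  obtain ⟨q, hq⟩ := h
  obtain ⟨q', hq'⟩ := h'
  refine ⟨q + q', fun B e hB hC => ?_⟩
  rw [Polynomial.eval_add]
  exact (hq B e hB hC).seq (hq' B e hB hC)

/-- The counters altered during a pass remain bounded by the same `B`, so polynomial bounds survive
nesting. -/
theorem PolyEmits.forLoop {r t : Reg} (hrt : r ≠ t) (h : PolyEmits C' P w)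
    (hC : ∀ e, C e → e t = 0 ∧ ∀ k < e r, C' (passEnv e r t k)) :
    PolyEmits C (forLoop r t P) fun e => cat (fun k => w (passEnv e r t k)) (e r) := by
  obtain ⟨q, hq⟩ := h
  refine ⟨.X * (q + 2) + .X * 2 + 2, fun B e hB hCe i a o => ?_⟩
  refine (Emits.forLoop hrt (hC e hCe).1 (fun k hk => hq B _ (fun x => ?_) ((hC e hCe).2 k hk))
    i a o).mono ?_
  · simp only [passEnv, Function.update_apply]
    have := hB r
    split_ifs
    · omega
    · omega
    · exact hB x
  · simp only [Polynomial.eval_add, Polynomial.eval_mul, Polynomial.eval_X, Polynomial.eval_ofNat]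
    gcongr <;> exact hB r

theorem PolyEmits.congr {C₂ : (Reg → ℕ) → Prop} (h : PolyEmits C P w) (hC : ∀ e, C₂ e → C e)
    (hw : ∀ e, C₂ e → w e = w' e) : PolyEmits C₂ P w' := by
  obtain ⟨q, hq⟩ := h
  exact ⟨q, fun B e hB hCe => hw e hCe ▸ hq B e hB (hC e hCe)⟩

/-- Writing a symbol several times. -/
def emitN (c : Symbol) : ℕ → WordProg α
  | 0 => skip
  | n + 1 => seq (emitN c n) (emit c)

theorem polyEmits_emitN (c : Symbol) (n : ℕ) :
    PolyEmits C (emitN c n : WordProg α) fun _ => List.replicate n c := by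
  induction n with
  | zero => exact polyEmits_skip
  | succ n ih => exact (ih.seq (polyEmits_emit c)).congr (fun _ h => h) fun _ _ => rfl

/-- The auxiliary counters are ready for the evaluation of a template. -/
def Ready (e : Reg → ℕ) : Prop := e .t₁ = 0 ∧ e .t₂ = 0 ∧ e .stride = e (.var .s) + 2

/-- The values of the parameters. -/
def params (e : Reg → ℕ) : LoopVar → ℕ := fun v => e (.var v)

/-- Writing as many boxes as a monomial says. -/
def monoProg : Mono → WordProg α
  | .const c => emitN .box c
  | .lin r c => forLoop (.var r) .t₁ (emitN .box c)
  | .quad r c => forLoop (.var r) .t₁ (forLoop .stride .t₂ (emitN .box c))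

theorem polyEmits_monoProg (m : Mono) :
    PolyEmits Ready (monoProg m : WordProg α) fun e =>
      List.replicate (m.eval (params e)) Symbol.box := by
  cases m with
  | const c => exact polyEmits_emitN _ c
  | lin r c =>
    refine ((polyEmits_emitN (C := fun _ => True) Symbol.box c).forLoop (by simp)
      fun e h => ⟨h.1, fun _ _ => trivial⟩).congr (fun _ h => h) fun e _ => ?_
    rw [cat_replicate]; rfl
  | quad r c =>
    refine (((polyEmits_emitN (C := fun _ => True) Symbol.box c).forLoop
      (r := .stride) (t := .t₂) (C := fun e => e .t₂ = 0) (by simp)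
      fun e h => ⟨h, fun _ _ => trivial⟩).forLoop (by simp)
      fun e h => ⟨h.1, fun k _ => by simp [passEnv, h.2.1]⟩).congr (fun _ h => h) fun e h => ?_
    simp only [cat_replicate]
    -- The outer loop does not touch `stride`, which holds the factor `s + 2`.
    have : ∀ k, passEnv e (.var r) .t₁ k .stride = e .stride := fun k => by simp [passEnv]
    simp only [this, cat_replicate, h.2.2, Mono.eval, params]
    congr 1
    ring

/-- Writing as many boxes as a sum of monomials says. -/
def sumProg : List Mono → WordProg α
  | [] => skip
  | m :: N => seq (sumProg N) (monoProg m)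

theorem polyEmits_sumProg (N : List Mono) :
    PolyEmits Ready (sumProg N : WordProg α) fun e =>
      List.replicate (evalSum (params e) N) Symbol.box := by
  induction N with
  | nil => exact polyEmits_skip
  | cons m N ih =>
    refine (ih.seq (polyEmits_monoProg m)).congr (fun _ h => h) fun e _ => ?_
    rw [List.replicate_append_replicate]
    rfl

/-- Writing the value of a template. -/
def templateProg : Template → WordProg α
  | .bot => emit .bot
  | .and s t => seq (templateProg t) (seq (templateProg s) (emit .and))
  | .imp s t => seq (templateProg t) (seq (templateProg s) (emit .imp))
  | .boxes N t => seq (templateProg t) (sumProg N)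

theorem word_boxes (n : ℕ) (φ : ModalFormula) :
    (boxes n φ).word = List.replicate n Symbol.box ++ φ.word := by
  induction n with
  | zero => rfl
  | succ n ih => rw [boxes, word, ih]; rfl

theorem polyEmits_templateProg (t : Template) :
    PolyEmits Ready (templateProg t : WordProg α) fun e => (t.eval (params e)).word := by
  induction t with
  | bot => exact polyEmits_emit _
  | and s t hs ht =>
    exact (ht.seq (hs.seq (polyEmits_emit _))).congr (fun _ h => h) fun e _ => by
      simp [Template.eval, word]
  | imp s t hs ht =>
    exact (ht.seq (hs.seq (polyEmits_emit _))).congr (fun _ h => h) fun e _ => by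
      simp [Template.eval, word]
  | boxes N t ht =>
    exact (ht.seq (polyEmits_sumProg N)).congr (fun _ h => h) fun e _ => by
      rw [Template.eval, word_boxes]

/-- The word to be written in front of a formula to turn it into a conjunction. -/
def conjPrefix (L : List ModalFormula) : List Symbol := L.flatMap fun φ => Symbol.and :: φ.word

/-- The conjunction of `ψ` and the formulas of a list. -/
def conjList (L : List ModalFormula) (ψ : ModalFormula) : ModalFormula :=
  L.foldr ModalFormula.and ψ

theorem word_conjList (L : List ModalFormula) (ψ : ModalFormula) :
    (conjList L ψ).word = conjPrefix L ++ ψ.word := by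
  induction L with
  | nil => rfl
  | cons φ L ih =>
    rw [conjList, List.foldr_cons, ← conjList, word, ih]
    simp [conjPrefix]

theorem conjPrefix_append (L L' : List ModalFormula) :
    conjPrefix (L ++ L') = conjPrefix L ++ conjPrefix L' := List.flatMap_append

theorem conjPrefix_cat (L : ℕ → List ModalFormula) (n : ℕ) :
    conjPrefix (cat L n) = cat (fun k => conjPrefix (L k)) n := by
  induction n with
  | zero => rfl
  | succ n ih => rw [cat, conjPrefix_append, ih, cat]

/-- Writing the values of a list of templates, as parts of a conjunction. -/
def listProg : List Template → WordProg α
  | [] => skip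
  | t :: L => seq (listProg L) (seq (templateProg t) (emit .and))

theorem polyEmits_listProg (L : List Template) :
    PolyEmits Ready (listProg L : WordProg α) fun e =>
      conjPrefix (L.map fun t => t.eval (params e)) := by
  induction L with
  | nil => exact polyEmits_skip
  | cons t L ih =>
    exact (ih.seq ((polyEmits_templateProg t).seq (polyEmits_emit _))).congr (fun _ h => h)
      fun e _ => by simp [conjPrefix]

/-- Writing the values of a list of templates for all the values of the loop indices. -/
def nestProg (L : List Template) : WordProg α :=
  forLoop .rj (.var .j) (forLoop .rp (.var .p) (forLoop .rd (.var .d) (listProg L)))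

/-- The partner counters of `rj`, `rp`, `rd` are the template parameters themselves, so the three
loops run through all triples of indices below `s`. -/
theorem polyEmits_nestProg (L : List Template) :
    PolyEmits (fun e => (((Ready e ∧ e .rd = e (.var .s) ∧ e (.var .d) = 0) ∧
        e .rp = e (.var .s) ∧ e (.var .p) = 0) ∧ e .rj = e (.var .s) ∧ e (.var .j) = 0))
      (nestProg L : WordProg α) fun e => conjPrefix
        (cat (fun j => cat (fun p => cat (fun d => L.map fun t =>
          t.eval (SpaceMachine.paramEnv j p d (e (.var .n)) (e (.var .s))))
            (e (.var .s))) (e (.var .s))) (e (.var .s))) := by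
  have h1 := (polyEmits_listProg (α := α) L).forLoop (r := .rd) (t := .var .d)
    (C := fun e => Ready e ∧ e .rd = e (.var .s) ∧ e (.var .d) = 0) (by simp)
    (fun e h => ⟨h.2.2, fun k _ => by simpa [Ready, passEnv] using h.1⟩)
  have h2 := h1.forLoop (r := .rp) (t := .var .p) (C := fun e => (Ready e ∧ e .rd = e (.var .s) ∧
      e (.var .d) = 0) ∧ e .rp = e (.var .s) ∧ e (.var .p) = 0) (by simp)
    (fun e h => ⟨h.2.2, fun k _ => by simpa [Ready, passEnv] using h.1⟩)
  have h3 := h2.forLoop (r := .rj) (t := .var .j) (C := fun e => ((Ready e ∧ e .rd = e (.var .s) ∧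
      e (.var .d) = 0) ∧ e .rp = e (.var .s) ∧ e (.var .p) = 0) ∧ e .rj = e (.var .s) ∧
      e (.var .j) = 0) (by simp)
    (fun e h => ⟨h.2.2, fun k _ => by simpa [Ready, passEnv] using h.1⟩)
  refine h3.congr (fun _ h => h) fun e h => ?_
  obtain ⟨⟨⟨-, hrd, -⟩, hrp, -⟩, hrj, -⟩ := h
  simp only [conjPrefix_cat]
  rw [hrj]
  congr 1
  funext j
  rw [show passEnv e .rj (.var .j) j .rp = e (.var .s) by simp [passEnv, hrp]]
  congr 1
  funext p
  rw [show passEnv (passEnv e .rj (.var .j) j) .rp (.var .p) p .rd = e (.var .s) by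
    simp [passEnv, hrd]]
  congr 1
  funext d
  congr 2
  funext t
  congr 1
  funext v
  cases v <;> simp [params, passEnv, SpaceMachine.paramEnv]

end StackProg

/-! ### Counter arithmetic: input length, powers, clearing. -/

namespace StackProg

variable {α : Type} {i a : List α} {o : List Symbol} {e : Reg → ℕ}

/-- Incrementing a counter several times. -/
def incrN (r : Reg) : ℕ → WordProg α
  | 0 => skip
  | n + 1 => seq (incrN r n) (incr r)

theorem runs_incrN (r : Reg) (n : ℕ) : (incrN r n).Runs (stk i a o e)
    (stk i a o (Function.update e r (e r + n))) (n + 1) := by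
  induction n with
  | zero => simpa [incrN] using runs_skip (stk i a o e)
  | succ n ih =>
    have := ih.seq (runs_incr r)
    simpa [Nat.add_assoc, incrN] using this

/-- A loop over the input. -/
theorem runs_loop_inp {body : α → WordProg α} {b : ℕ} (x : List α) (A : ℕ → List α)
    (O : ℕ → List Symbol) (E : ℕ → Reg → ℕ)
    (h : ∀ (k : ℕ) (hk : k < x.length), (body x[k]).Runs
      (stk (x.drop (k + 1)) (A k) (O k) (E k))
      (stk (x.drop (k + 1)) (A (k + 1)) (O (k + 1)) (E (k + 1))) b) :
    (loop Stk.inp body : WordProg α).Runs (stk x (A 0) (O 0) (E 0))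
      (stk [] (A x.length) (O x.length) (E x.length)) (x.length * (b + 1) + 1) := by
  have := Run.loop_of_forall (Γ := StkAlph α) (k := Stk.inp) (body := body) (b := b) x.length
    (fun j => stk (x.drop (x.length - j)) (A (x.length - j)) (O (x.length - j))
      (E (x.length - j))) (by simp [stk]) (fun j hj => by
      obtain ⟨k, hk, rfl⟩ : ∃ k, k < x.length ∧ j = x.length - (k + 1) :=
        ⟨x.length - (j + 1), by omega, by omega⟩
      refine ⟨x[k], x.drop (k + 1), ?_, ?_⟩
      · change x.drop (x.length - (x.length - (k + 1) + 1)) = _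
        rw [show x.length - (x.length - (k + 1) + 1) = k by omega]
        exact List.drop_eq_getElem_cons hk
      · rw [update_inp, show x.length - (x.length - (k + 1) + 1) = k by omega,
          show x.length - (x.length - (k + 1)) = k + 1 by omega]
        exact h k hk)
  simp only [Nat.sub_self, Nat.sub_zero, List.drop_zero, List.drop_length] at this
  exact this

theorem runs_restore : (loop Stk.aux fun c => push Stk.inp c : WordProg α).Runs (stk i a o e)
    (stk (a.reverseAux i) [] o e) (a.length * 2 + 1) := by
  induction a generalizing i with
  | nil => exact ⟨1, by simp, Run.loop_nil (Γ := StkAlph α) rfl⟩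
  | cons c a ih =>
    obtain ⟨t, ht, h⟩ := ih (i := c :: i)
    obtain ⟨t', ht', h'⟩ := runs_push_inp (i := i) (a := a) (o := o) (e := e) c
    refine ⟨1 + t' + t, ?_, Run.loop_cons (Γ := StkAlph α) (a := c) (l := a) rfl ?_ h⟩
    · rw [List.length_cons]; omega
    · rw [update_aux]
      exact h'

/-- Adding the input length and `c` to the counter `base`. -/
def countProg (c : ℕ) : WordProg α :=
  seq (loop Stk.inp fun c => seq (push Stk.aux c) (incr .base))
    (seq (loop Stk.aux fun c => push Stk.inp c) (incrN .base c))

/-- Counting consumes the input, which is saved in reverse on `aux` and then poured back. -/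
theorem runs_countProg (c : ℕ) (x : List α) : (countProg c).Runs (stk x [] o e)
    (stk x [] o (Function.update e .base (e .base + (x.length + c)))) (x.length * 5 + c + 3) := by
  have h1 := runs_loop_inp (body := fun c => seq (push Stk.aux c) (incr .base)) (b := 2) x
    (fun k => (x.take k).reverse) (fun _ => o)
    (fun k => Function.update e .base (e .base + k)) (fun k hk => by
      have := (runs_push_aux (i := x.drop (k + 1)) (a := (x.take k).reverse) (o := o)
        (e := Function.update e .base (e .base + k)) x[k]).seq (runs_incr .base)
      rw [List.take_succ_eq_append_getElem hk, List.reverse_append]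
      simp only [Function.update_idem, Function.update_self, Nat.add_assoc] at this
      exact this)
  have h2 := runs_restore (i := []) (a := x.reverse) (o := o)
    (e := Function.update e .base (e .base + x.length))
  have h3 := runs_incrN (i := x) (a := []) (o := o)
    (e := Function.update e .base (e .base + x.length)) .base c
  simp only [List.take_zero, List.reverse_nil, Nat.add_zero, Function.update_eq_self,
    List.take_length] at h1
  rw [List.reverseAux_eq, List.reverse_reverse, List.append_nil, List.length_reverse] at h2
  simp only [Function.update_idem, Function.update_self, Nat.add_assoc] at h3
  exact (h1.seq (h2.seq h3)).mono (by omega)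

/-- Multiplying the counter `cur` by the counter `base`. -/
def mulProg : WordProg α :=
  seq (loop (Stk.ctr .cur) fun _ => forLoop .base .t₁ (incr .new))
    (loop (Stk.ctr .new) fun _ => incr .cur)

/-- The values of the counters during the computation of a power. -/
def powEnv (m c v : ℕ) : Reg → ℕ
  | .base => m
  | .cur => c
  | .new => v
  | _ => 0

/-- After `k` passes `cur` is `c - k` and `new` is `k * m`; then `new` is moved back to `cur`. -/
theorem runs_mulProg (m c : ℕ) : (mulProg : WordProg α).Runs (stk i a o (powEnv m c 0))
    (stk i a o (powEnv m (c * m) 0)) (c * (m * 5 + 3) + c * m * 2 + 2) := by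
  have h1 := runs_loop_ctr (α := α) (r := .cur) (P := forLoop .base .t₁ (incr .new))
    (b := m * 3 + m * 2 + 2) c (fun _ => i) (fun _ => a) (fun _ => o)
    (fun k => powEnv m (c - k) (k * m)) (fun _ _ => rfl) (fun k hk => by
      have := runs_forLoop (α := α) (i := i) (a := a) (r := .base) (t := .t₁) (by simp)
        (P := incr .new) (b := 1) (fun _ => o) (fun l => powEnv m (c - k - 1) (k * m + l)) m
        (fun _ => rfl) (fun _ => rfl) (fun l hl => by
          convert runs_incr Reg.new using 2
          funext x
          cases x <;> simp [passEnv, powEnv]; omega)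
      convert this using 2
      · funext x
        cases x <;> simp [powEnv]
      · congr 1; rw [Nat.succ_mul])
  have h2 := runs_loop_ctr (α := α) (r := .new) (P := incr .cur) (b := 1) (c * m)
    (fun _ => i) (fun _ => a) (fun _ => o) (fun k => powEnv m k (c * m - k))
    (fun _ _ => rfl) (fun k hk => by
      convert runs_incr Reg.cur using 2
      funext x
      cases x <;> simp [powEnv]; omega)
  simp only [Nat.sub_zero, Nat.zero_mul, Nat.sub_self] at h1 h2
  exact (h1.seq h2).mono (by ring_nf; omega)

/-- Computing a power of the counter `base`. -/
def powProg : ℕ → WordProg α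
  | 0 => incr .cur
  | D + 1 => seq (powProg D) mulProg

/-- A bound for the time of `powProg`. -/
noncomputable def powTime : ℕ → Polynomial ℕ
  | 0 => 1
  | D + 1 => powTime D + (.X ^ D * (.X * 5 + 3) + .X ^ D * .X * 2 + 2)

theorem runs_powProg (m D : ℕ) : (powProg D : WordProg α).Runs (stk i a o (powEnv m 0 0))
    (stk i a o (powEnv m (m ^ D) 0)) ((powTime D).eval m) := by
  induction D with
  | zero =>
    have e : Function.update (powEnv m 0 0) Reg.cur (powEnv m 0 0 Reg.cur + 1) =
        powEnv m (m ^ 0) 0 := by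
      funext x
      cases x <;> simp [powEnv]
    have := runs_incr (α := α) (i := i) (a := a) (o := o) (e := powEnv m 0 0) Reg.cur
    rw [e] at this
    simpa only [powProg, powTime, Polynomial.eval_one] using this
  | succ D ih =>
    have := ih.seq (runs_mulProg m (m ^ D))
    rw [← pow_succ] at this
    simpa only [powTime, powProg, Polynomial.eval_add, Polynomial.eval_mul, Polynomial.eval_pow,
      Polynomial.eval_X, Polynomial.eval_ofNat, pow_succ] using this

/-- Moving the counter `cur` to the counters `s`, `rj`, `rp`, `rd`, and to `stride` with `2`
added. -/
def spreadProg : WordProg α :=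
  seq (loop (Stk.ctr .cur) fun _ => seq (incr (.var .s)) (seq (incr .stride) (seq (incr .rj)
    (seq (incr .rp) (incr .rd))))) (incrN .stride 2)

/-- The values of the counters. -/
def mainEnv (m c s t k : ℕ) : Reg → ℕ
  | .var .s => s
  | .var .n => k
  | .stride => t
  | .rj => s
  | .rp => s
  | .rd => s
  | .base => m
  | .cur => c
  | _ => 0

theorem runs_spreadProg (m s : ℕ) : (spreadProg : WordProg α).Runs (stk i a o (powEnv m s 0))
    (stk i a o (mainEnv m 0 s (s + 2) 0)) (s * 6 + 4) := by
  have h1 := runs_loop_ctr (α := α) (r := .cur) (P := seq (incr (.var .s))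
    (seq (incr .stride) (seq (incr .rj) (seq (incr .rp) (incr .rd))))) (b := 5) s
    (fun _ => i) (fun _ => a) (fun _ => o) (fun k => mainEnv m (s - k) k k 0)
    (fun _ _ => rfl) (fun k hk => by
      convert (runs_incr (.var .s)).seq ((runs_incr .stride).seq ((runs_incr .rj).seq
        ((runs_incr .rp).seq (runs_incr .rd)))) using 2
      funext x
      rcases x with v | _
      · cases v <;> simp [mainEnv]
      all_goals simp [mainEnv]
      omega)
  have h2 := runs_incrN (i := i) (a := a) (o := o) (e := mainEnv m 0 s s 0) .stride 2
  simp only [Nat.sub_zero, Nat.sub_self] at h1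
  have e1 : mainEnv m s 0 0 0 = powEnv m s 0 := by
    funext x
    rcases x with v | _
    · cases v <;> rfl
    all_goals rfl
  have e2 : Function.update (mainEnv m 0 s s 0) Reg.stride (mainEnv m 0 s s 0 Reg.stride + 2) =
      mainEnv m 0 s (s + 2) 0 := by
    funext x
    rcases x with v | _
    · cases v <;> simp [mainEnv]
    all_goals simp [mainEnv]
  rw [e1] at h1
  rw [e2] at h2
  exact (h1.seq h2).mono (by omega)

/-- Emptying counters. -/
def clearProg : List Reg → WordProg α
  | [] => skip
  | r :: L => seq (loop (Stk.ctr r) fun _ => skip) (clearProg L)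

theorem runs_clearProg {B : ℕ} (L : List Reg) (e : Reg → ℕ) (hB : ∀ r, e r ≤ B) :
    (clearProg L).Runs (stk i a o e) (stk i a o fun r => if r ∈ L then 0 else e r)
      (L.length * (B * 2 + 1) + 1) := by
  induction L generalizing e with
  | nil => simpa [clearProg] using runs_skip (stk i a o e)
  | cons r L ih =>
    have h1 := runs_loop_ctr (α := α) (r := r) (P := skip) (b := 1) (e r) (fun _ => i)
      (fun _ => a) (fun _ => o) (fun k => Function.update e r (e r - k)) (fun _ _ => by simp)
      (fun k hk => by
        convert runs_skip _ using 2
        rw [Function.update_idem, Nat.sub_sub])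
    simp only [Nat.sub_zero, Function.update_eq_self, Nat.sub_self] at h1
    have h2 := ih (Function.update e r 0) (fun r' => by
      rw [Function.update_apply]
      split_ifs
      · omega
      · exact hB r')
    have e1 : (fun r' => if r' ∈ L then 0 else Function.update e r 0 r') =
        fun r' => if r' ∈ r :: L then 0 else e r' := by
      funext r'
      by_cases h : r' = r <;> simp [h]
    rw [e1] at h2
    refine (h1.seq h2).mono ?_
    have := hB r
    rw [List.length_cons, Nat.succ_mul]
    omega

/-- Writing `⊥ → ⊥`, followed by `⊥`. -/
def headProg : WordProg α := seq (emit .bot) (seq (emit .bot) (seq (emit .bot) (emit .imp)))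

theorem emits_headProg : (headProg : WordProg α).Emits e [.imp, .bot, .bot, .bot] 4 :=
  (emits_emit _).seq ((emits_emit _).seq ((emits_emit _).seq (emits_emit _)))

end StackProg

/-! ### The reduction and its correctness. -/

namespace SpaceMachine

open StackProg

variable {α : Type} (M : SpaceMachine α)

/-- The conjuncts for the input letter number `k`. -/
noncomputable def letterList (x : List α) (s k : ℕ) : List ModalFormula :=
  x[k]?.toList.map fun a => (M.letterTemplate a).eval (paramEnv 0 0 0 k s)

/-- The list of all the templates. -/
noncomputable def templateList : List Template := M.finite_templateSet.toFinset.toList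

/-- The list of all the conjuncts. -/
noncomputable def conjunctList (x : List α) (s : ℕ) : List ModalFormula :=
  cat (fun j => cat (fun p => cat (fun d =>
    M.templateList.map fun t => t.eval (paramEnv j p d x.length s)) s) s) s ++
  cat (M.letterList x s) x.length

theorem mem_conjunctList {x : List α} {s : ℕ} {φ : ModalFormula} :
    φ ∈ M.conjunctList x s ↔ φ ∈ M.conjuncts x s := by
  simp only [conjunctList, List.mem_append, mem_cat, templateList, List.mem_map,
    Finset.mem_toList, Set.Finite.mem_toFinset, conjuncts, Set.mem_ofPred_eq]
  refine or_congr ⟨?_, ?_⟩ ⟨?_, ?_⟩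
  · rintro ⟨j, hj, p, hp, d, hd, t, ht, rfl⟩
    exact ⟨t, ht, j, hj, p, hp, d, hd, rfl⟩
  · rintro ⟨t, ht, j, hj, p, hp, d, hd, rfl⟩
    exact ⟨j, hj, p, hp, d, hd, t, ht, rfl⟩
  · rintro ⟨k, hk, h⟩
    rw [letterList, List.getElem?_eq_getElem hk] at h
    exact ⟨k, hk, by simpa using h⟩
  · rintro ⟨k, hk, rfl⟩
    refine ⟨k, hk, ?_⟩
    rw [letterList, List.getElem?_eq_getElem hk]
    simp

/-- The constant formula assigned to the input `x`: the negation of the conjunction of all the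
conjuncts. -/
noncomputable def reductionFormula (x : List α) (s : ℕ) : ModalFormula :=
  .imp (conjList (M.conjunctList x s) (.imp .bot .bot)) .bot

/-- Writing the conjuncts for the input letters. -/
noncomputable def letterProg : WordProg α :=
  loop Stk.inp fun a => seq (listProg [M.letterTemplate a]) (incr (.var .n))

/-- The input is consumed for good. The parameter `n` counts the letters read and ends as the input
length, the value needed by the template for blank cells. -/
theorem runs_letterProg [Finite α] : ∃ q : Polynomial ℕ, ∀ (x : List α) (o : List Symbol)
    (m s B : ℕ), s + 2 ≤ B → m ≤ B → x.length ≤ B →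
    M.letterProg.Runs (stk x [] o (mainEnv m 0 s (s + 2) 0))
      (stk [] [] (conjPrefix (cat (M.letterList x s) x.length) ++ o)
        (mainEnv m 0 s (s + 2) x.length)) (x.length * (q.eval B + 2) + 1) := by
  have := Fintype.ofFinite α
  choose q hq using fun a : α => polyEmits_listProg (α := α) [M.letterTemplate a]
  -- The alphabet is finite, so the sum bounds the time for every letter.
  refine ⟨∑ a, q a, fun x o m s B hs hm hx => ?_⟩
  have := runs_loop_inp (body := fun a => seq (listProg [M.letterTemplate a]) (incr (.var .n)))
    (b := (∑ a, q a).eval B + 1) x (fun _ => [])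
    (fun k => conjPrefix (cat (M.letterList x s) k) ++ o)
    (fun k => mainEnv m 0 s (s + 2) k) (fun k hk => by
      have h := hq x[k] B (mainEnv m 0 s (s + 2) k) (by
        rintro (v | _)
        · cases v <;> (simp only [mainEnv]; omega)
        all_goals (simp only [mainEnv]; omega)) ⟨rfl, rfl, rfl⟩
        (x.drop (k + 1)) [] (conjPrefix (cat (M.letterList x s) k) ++ o)
      have hle : (q x[k]).eval B ≤ (∑ a, q a).eval B := by
        rw [Polynomial.eval_finsetSum]
        exact Finset.single_le_sum (f := fun a => (q a).eval B) (fun _ _ => Nat.zero_le _)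
          (Finset.mem_univ _)
      convert (h.mono hle).seq (runs_incr (.var .n)) using 2
      · rw [cat, conjPrefix_append, List.append_assoc, letterList, List.getElem?_eq_getElem hk]
        have : params (mainEnv m 0 s (s + 2) k) = paramEnv 0 0 0 k s := by
          funext v
          cases v <;> rfl
        simp only [List.map_cons, List.map_nil, this]
        rfl
      · funext x
        rcases x with v | _
        · cases v <;> simp [mainEnv]
        all_goals simp [mainEnv])
  simpa [cat, conjPrefix, letterProg] using this

/-- The program that computes the reduction. -/
noncomputable def reductionProg (c D : ℕ) : WordProg α :=
  seq (countProg c) (seq (powProg D) (seq spreadProg (seq headProg (seq M.letterProg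
    (seq (nestProg M.templateList) (seq (emit .imp) (clearProg Finset.univ.toList)))))))

/-- The output is a stack, so the formula is written from its last symbol to its first. The counters
are cleared at the end because only the output stack may be nonempty on halting. -/
theorem runs_reductionProg [Finite α] (c D : ℕ) : ∃ q : Polynomial ℕ, ∀ x : List α,
    (M.reductionProg c D).Runs (stk x [] [] fun _ => 0)
      (stk [] [] (M.reductionFormula x ((x.length + c) ^ D)).word fun _ => 0)
      (q.eval x.length) := by
  obtain ⟨q₁, hq₁⟩ := M.runs_letterProg
  obtain ⟨q₂, hq₂⟩ := polyEmits_nestProg (α := α) M.templateList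
  let mP : Polynomial ℕ := .X + .C c
  let sP : Polynomial ℕ := mP ^ D
  let bP : Polynomial ℕ := .X + mP + sP + 2
  refine ⟨(.X * 5 + .C c + 3) + ((powTime D).comp mP + ((sP * 6 + 4) + (4 +
    ((.X * (q₁.comp bP + 2) + 1) + (q₂.comp bP + (1 +
      (.C (Finset.univ.toList : List Reg).length * (bP * 2 + 1) + 1))))))), fun x => ?_⟩
  obtain ⟨m, hm⟩ : ∃ m, m = x.length + c := ⟨_, rfl⟩
  obtain ⟨s, hs⟩ : ∃ s, s = m ^ D := ⟨_, rfl⟩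
  obtain ⟨B, hB⟩ : ∃ B, B = x.length + m + s + 2 := ⟨_, rfl⟩
  have em : mP.eval x.length = m := by simp [mP, hm]
  have es : sP.eval x.length = s := by simp [sP, em, hs]
  have eb : bP.eval x.length = B := by simp [bP, em, es, hB]
  simp only [Polynomial.eval_add, Polynomial.eval_mul, Polynomial.eval_comp, em, es, eb,
    Polynomial.eval_X, Polynomial.eval_C, Polynomial.eval_ofNat, Polynomial.eval_one]
  rw [← hm, ← hs]
  have hbound : ∀ r, mainEnv m 0 s (s + 2) x.length r ≤ B := by
    rintro (v | _)
    · cases v <;> (simp only [mainEnv]; omega)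
    all_goals (simp only [mainEnv]; omega)
  have h1 := runs_countProg (o := []) (e := fun _ => 0) c x
  have e1 : Function.update (fun _ => 0) Reg.base (0 + (x.length + c)) = powEnv m 0 0 := by
    funext r
    cases r <;> simp [powEnv, hm]
  rw [e1] at h1
  have h2 := runs_powProg (i := x) (a := []) (o := []) m D
  rw [← hs] at h2
  have h3 := runs_spreadProg (i := x) (a := []) (o := []) m s
  have h4 := emits_headProg (e := mainEnv m 0 s (s + 2) 0) x [] []
  have h5 := hq₁ x ([.imp, .bot, .bot, .bot] ++ []) m s B (by omega) (by omega) (by omega)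
  have h6 := hq₂ B (mainEnv m 0 s (s + 2) x.length) hbound
    ⟨⟨⟨⟨rfl, rfl, rfl⟩, rfl, rfl⟩, rfl, rfl⟩, rfl, rfl⟩ [] []
    (conjPrefix (cat (M.letterList x s) x.length) ++ ([.imp, .bot, .bot, .bot] ++ []))
  have h7 := runs_clearProg (α := α) (i := []) (a := []) (o := (M.reductionFormula x s).word)
    Finset.univ.toList _ hbound
  simp only [Finset.mem_toList, Finset.mem_univ, if_true] at h7
  refine h1.seq (h2.seq (h3.seq (h4.seq (h5.seq (h6.seq ((runs_emit .imp).seq ?_))))))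
  convert h7 using 2
  simp only [reductionFormula, word, word_conjList, conjunctList, conjPrefix_append,
    List.append_assoc, List.append_nil]
  rfl

theorem isConstant_reductionFormula (x : List α) (s : ℕ) :
    (M.reductionFormula x s).IsConstant := by
  have h : ∀ L : List ModalFormula, (∀ φ ∈ L, φ.IsConstant) →
      (conjList L (.imp .bot .bot)).IsConstant := by
    intro L
    induction L with
    | nil => exact fun _ => ⟨trivial, trivial⟩
    | cons φ L ih =>
      exact fun h => ⟨h φ (by simp), ih fun ψ hψ => h ψ (List.mem_cons_of_mem _ hψ)⟩
  refine ⟨h _ fun φ hφ => ?_, trivial⟩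
  rcases M.mem_conjunctList.1 hφ with ⟨t, -, j, -, p, -, d, -, rfl⟩ | ⟨k, hk, rfl⟩ <;>
    exact Template.isConstant_eval _ _

theorem sat_conjList {W : Type} (R : W → W → Prop) (v : ℕ → W → Prop) (L : List ModalFormula)
    (w : W) : Sat R v (conjList L (.imp .bot .bot)) w ↔ ∀ φ ∈ L, Sat R v φ w := by
  induction L with
  | nil => simp [conjList]
  | cons φ L ih =>
    rw [List.forall_mem_cons, ← ih]
    rfl

theorem reductionFormula_mem_logicK {x : List α} {s : ℕ} (hx : ∀ t, (M.run x t).head < s)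
    (h : (M.run x (2 ^ s)).state ∈ M.accept) : M.reductionFormula x s ∈ logicK := by
  intro W R v w hw
  rw [sat_conjList] at hw
  exact not_accept_of_sat_conjuncts hx (fun φ hφ => hw φ (M.mem_conjunctList.2 hφ)) h

theorem reductionFormula_not_mem_logicWGrz {x : List α} {s : ℕ}
    (h : (M.run x (2 ^ s)).state ∉ M.accept) : M.reductionFormula x s ∉ logicWGrz := by
  intro hmem
  -- The valuation is arbitrary: the conjuncts contain no variables.
  refine sat_of_mem_logicWGrz (R := TreeWorld.Rel s (M.NodeGadget x s))
    (fun _ _ _ => TreeWorld.rel_trans s (M.NodeGadget x s))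
    (TreeWorld.rel_wf s _) hmem (fun _ _ => False) (TreeWorld.node 0 0) ?_
  rw [sat_conjList]
  exact fun φ hφ => sat_conjuncts M x s _ h (M.mem_conjunctList.1 hφ)

end SpaceMachine

/-! ### Polynomial bounds and the main theorem. -/

/-- Bounds of this shape are easy to compute with counters: one addition and `D` multiplications. -/
theorem exists_eval_le_pow (p : Polynomial ℕ) : ∃ c D, ∀ n, p.eval n ≤ (n + c) ^ D := by
  induction p using Polynomial.induction_on' with
  | add p q hp hq =>
    obtain ⟨c, D, hp⟩ := hp
    obtain ⟨c', D', hq⟩ := hq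
    -- The `2` makes the base at least `2`, so one additional factor absorbs the sum of the two
    -- powers.
    refine ⟨c + c' + 2, D + D' + 1, fun n => ?_⟩
    obtain ⟨N, hN⟩ : ∃ N, N = n + (c + c' + 2) := ⟨_, rfl⟩
    rw [Polynomial.eval_add, ← hN]
    have h1 : (n + c) ^ D ≤ N ^ (D + D') :=
      (Nat.pow_le_pow_left (by omega) _).trans (Nat.pow_le_pow_right (by omega) (by omega))
    have h2 : (n + c') ^ D' ≤ N ^ (D + D') :=
      (Nat.pow_le_pow_left (by omega) _).trans (Nat.pow_le_pow_right (by omega) (by omega))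
    calc p.eval n + q.eval n ≤ N ^ (D + D') * 2 := by linarith [hp n, hq n]
      _ ≤ N ^ (D + D') * N := Nat.mul_le_mul_left _ (by omega)
      _ = N ^ (D + D' + 1) := (pow_succ _ _).symm
  | monomial k a =>
    refine ⟨a, k + 1, fun n => ?_⟩
    rw [Polynomial.eval_monomial, pow_succ, Nat.mul_comm]
    exact Nat.mul_le_mul (Nat.pow_le_pow_left (by omega) _) (by omega)

theorem StackProg.stk_inp {α : Type} (x : List α) :
    StackProg.stk x [] [] (fun _ => 0) = StackProg.single (Γ := StkAlph α) Stk.inp x := by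
  funext k
  cases k <;> simp [StackProg.single, StackProg.stk]

theorem StackProg.stk_out {α : Type} (o : List Symbol) :
    StackProg.stk ([] : List α) [] o (fun _ => 0) =
      StackProg.single (Γ := StkAlph α) Stk.out o := by
  funext k
  cases k <;> simp [StackProg.single, StackProg.stk]

/-- For every set `L` of modal formulas (in particular, every logic) with `K ⊆ L ⊆ wGrz`, the
problem of deciding the constant fragment of `L` is PSPACE-hard. -/
theorem mainTheorem1 (L : Set ModalFormula) (hK : logicK ⊆ L) (hW : L ⊆ logicWGrz) :
    PSPACEHard (decisionProblem (constantFragment L)) := by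
  intro α _ A ⟨M, p, hdec, hspace⟩
  -- The depth must dominate the exponent `|Q| + m * (|Γ| + 1)` of `card_mul_le_two_pow`, with `m`
  -- the space bound; it then dominates `m` too, so the head stays at positions below `s`.
  obtain ⟨c, D, hcD⟩ := exists_eval_le_pow
    (.C (Nat.card M.Q) + p * .C (Nat.card M.Γ + 1))
  simp only [Polynomial.eval_add, Polynomial.eval_mul, Polynomial.eval_C] at hcD
  have hhead : ∀ (x : List α) (t : ℕ), (M.run x t).head < (x.length + c) ^ D := by
    intro x t
    have h1 := hspace x _ (M.reaches_run x t)
    have h2 := hcD x.length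
    rw [Nat.mul_succ] at h2
    omega
  have hacc : ∀ x, (M.run x (2 ^ (x.length + c) ^ D)).state ∈ M.accept ↔ x ∈ A := fun x =>
    SpaceMachine.mem_iff_of_decides hdec (SpaceMachine.step_run_eq_none hdec (hspace x)
      (card_mul_le_two_pow _ _ _ _ (hcD x.length)))
  refine ⟨fun x => (M.reductionFormula x ((x.length + c) ^ D)).word, ?_, fun x => ?_⟩
  · obtain ⟨q, hq⟩ := M.runs_reductionProg c D
    refine StackProg.nonempty_computableInPolyTime (Γ := StkAlph α) Stk.inp Stk.out
      (M.reductionProg c D) _ q fun x => ?_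
    have := hq x
    rw [StackProg.stk_inp, StackProg.stk_out] at this
    exact this
  · constructor
    · intro hx
      exact ⟨_, ⟨hK (M.reductionFormula_mem_logicK (hhead x) ((hacc x).2 hx)),
        M.isConstant_reductionFormula x _⟩, rfl⟩
    · rintro ⟨φ, ⟨hφ, hconst⟩, hword⟩
      by_contra hx
      -- Membership in the decision problem only gives some constant formula with this word; unique
      -- readability identifies it with the reduction formula.
      rw [word_injective_of_isConstant hconst (M.isConstant_reductionFormula x _) hword] at hφ
      exact M.reductionFormula_not_mem_logicWGrz (fun h => hx ((hacc x).1 h)) (hW hφ)
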